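/- Let $\alpha>-1$, $\nu>0$, $\lambda,t\ge 0$, $\lambda^2+t^2\neq0$, $n\in\mathbb N=\{1,2,\dots\}$. Let $\rho_\nu(x)=2x^{\nu/2}K_\nu(2\sqrt x)$ for $x>0$, where $K_\nu$ is the modified Bessel function, and $\rho_\nu(0)=\Gamma(\nu)$. Let $P_m(x)=P_m(x;\lambda,t)=a_mx^m+b_mx^{m-1}+\dots$ ($m\ge 0$, $b_0=0$) be the orthonormal polynomials of the weight $x^\alpha e^{-\lambda x}\rho_\nu(xt)$ on $(0,\infty)$, with the sign of the leading coefficient normalized by $(-1)^m a_m>0$; that is, $\deg P_m=m$ and $$\int_0^\infty P_m(x;\lambda,t)P_k(x;\lambda,t)\,e^{-\lambda x}\rho_\nu(xt)\,x^\alpha\,dx=\delta_{m,k}\qquad(m,k\ge0).$$ (These integrals converge, and such polynomials exist.) Put $A_m=a_{m-1}/a_m$ for $m\ge 1$ and $B_m=\dfrac{b_m}{a_m}-\dfrac{b_{m+1}}{a_{m+1}}$; $a_m,b_m,A_m,B_m$ are functions of $(\lambda,t)$. For $\lambda>0$ let $$\hat L_n^\alpha(x;\lambda)=\lambda^{(1+\alpha)/2}\left(\frac{n!}{\Gamma(n+\alpha+1)\Gamma(\nu)}\right)^{1/2}L_n^\alpha(\lambda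 x),$$ where $L_n^\alpha$ is the associated Laguerre polynomial. Then, for all real $x$: (i) If $t>0$, then $$P_n(x;\lambda,t)=\int_0^\lambda\exp\left(\tfrac12\int_\xi^\lambda B_n(y,t)\,dy\right)A_n(\xi,t)P_{n-1}(x;\xi,t)\,d\xi+\exp\left(\tfrac12\int_0^\lambda B_n(y,t)\,dy\right)P_n(x;0,t),$$ where the function $B_n(\cdot,t)$ and the integrand of the outer integral are integrable on $[0,\lambda]$. (ii) If $\lambda>0$, then $P_n(x;\lambda,0)=\hat L_n^\alpha(x;\lambda)$, $$a_n(\lambda,0)=\frac{(-1)^n\lambda^{n+(1+\alpha)/2}}{\left(n!\,\Gamma(n+\alpha+1)\Gamma(\nu)\right)^{1/2}},$$ and $$P_n(x;\lambda,t)=a_n(\lambda,t)\int_0^t\left[x\frac{\partial}{\partial x}P_n(x;\lambda,y)-nP_n(x;\lambda,y)-\lambda A_n(\lambda,y)P_{n-1}(x;\lambda,y)\right]\frac{dy}{y\,a_n(\lambda,y)}$$ $$+(-1)^n\lambda^{-n-(1+\alpha)/2}\left[n!\,\Gamma(n+\alpha+1)\Gamma(\nu)\right]^{1/2}a_n(\lambda,t)\,\hat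 L_n^\alpha(x;\lambda),$$ where the integrand is integrable on $(0,t)$. -/

import Mathlib

open MeasureTheory

open scoped Polynomial Nat

namespace PrudnikovLaguerre

noncomputable section

/-- The modified Bessel (Macdonald) function `K_ν(z)` for `z > 0`, by its classical integral
`K_ν(z) = ∫_0^∞ e^{-z cosh u} cosh (ν u) du`. -/
def macdonaldK (ν z : ℝ) : ℝ :=
  ∫ u in Set.Ioi (0 : ℝ), Real.exp (-z * Real.cosh u) * Real.cosh (ν * u)

/-- `ρ_ν(x) = 2 x^{ν/2} K_ν(2 √x)` for `x > 0`, and `ρ_ν(0) = Γ(ν)` (the limit value for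
`ν > 0`). -/
def rho (ν x : ℝ) : ℝ :=
  if x = 0 then Real.Gamma ν else 2 * x ^ (ν / 2) * macdonaldK ν (2 * Real.sqrt x)

/-- The weight `x^α e^{-l x} ρ_ν(x t)` on `(0, ∞)`. -/
def weight (α ν l t x : ℝ) : ℝ :=
  x ^ α * Real.exp (-l * x) * rho ν (x * t)

/-- The functional `q ↦ ∫_0^∞ q(x) x^α e^{-l x} ρ_ν(x t) dx` on polynomials. -/
def functional (α ν l t : ℝ) (q : ℝ[X]) : ℝ :=
  ∫ x in Set.Ioi (0 : ℝ), q.eval x * weight α ν l t x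

/-- The monic orthogonal polynomials of the weight: Gram-Schmidt applied to `1, x, x², …`. -/
def monicP (α ν l t : ℝ) (n : ℕ) : ℝ[X] :=
  Polynomial.X ^ n - ∑ k : Fin n,
    Polynomial.C
      (functional α ν l t (Polynomial.X ^ n * monicP α ν l t k) /
        functional α ν l t (monicP α ν l t k ^ 2)) *
      monicP α ν l t k
termination_by n
decreasing_by all_goals exact k.isLt

/-- The orthonormal polynomials `P_n(x; l, t)` of the weight, with leading coefficient of
sign `(-1)^n`. -/
def P (α ν l t : ℝ) (n : ℕ) : ℝ[X] :=
  Polynomial.C ((-1) ^ n / Real.sqrt (functional α ν l t (monicP α ν l t n ^ 2))) *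
    monicP α ν l t n

/-- `a_n(l, t)`, the coefficient of `x^n` in `P_n(x; l, t)`. -/
def a (α ν l t : ℝ) (n : ℕ) : ℝ := (P α ν l t n).coeff n

/-- `b_n(l, t)`, the coefficient of `x^{n-1}` in `P_n(x; l, t)` (zero for `n = 0`). -/
def b (α ν l t : ℝ) : ℕ → ℝ
  | 0 => 0
  | n + 1 => (P α ν l t (n + 1)).coeff n

/-- The recurrence coefficient `A_n = a_{n-1} / a_n` (with `a_{-1} = 0`). -/
def A (α ν l t : ℝ) : ℕ → ℝ
  | 0 => 0
  | n + 1 => a α ν l t n / a α ν l t (n + 1)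

/-- The recurrence coefficient `B_n = b_n / a_n - b_{n+1} / a_{n+1}`. -/
def B (α ν l t : ℝ) (n : ℕ) : ℝ :=
  b α ν l t n / a α ν l t n - b α ν l t (n + 1) / a α ν l t (n + 1)

/-- The associated Laguerre polynomial
`L_n^α(x) = ∑_k (-1)^k Γ(n+α+1) / (Γ(k+α+1) (n-k)! k!) x^k`, for `α > -1`. -/
def laguerre (α : ℝ) (n : ℕ) : ℝ[X] :=
  ∑ k ∈ Finset.range (n + 1),
    Polynomial.C ((-1) ^ k * Real.Gamma (n + α + 1) /
      (Real.Gamma (k + α + 1) * ((n - k)! : ℕ) * (k ! : ℕ))) * Polynomial.X ^ k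

/-- The modified Laguerre polynomial: `L_n^α(l x)`, normalized to be orthonormal for the weight
`Γ(ν) x^α e^{-l x}`. -/
def modLaguerre (α ν l : ℝ) (n : ℕ) : ℝ[X] :=
  Polynomial.C (l ^ ((1 + α) / 2) *
      Real.sqrt ((n ! : ℕ) / (Real.Gamma (n + α + 1) * Real.Gamma ν))) *
    (laguerre α n).comp (Polynomial.C l * Polynomial.X)

end

end PrudnikovLaguerre

namespace PrudnikovLaguerre

noncomputable section

open Polynomial Filter Topology

/-! Everything about the weight is carried by its moments. Writing `ρ_ν(x) = ∫ u^(ν-1) e^(-u-x/u)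
du` and integrating in `x` first gives `m_k = Γ(α+k+1) ∫ u^(ν-1) e^(-u) (l + t/u)^(-(α+k+1)) du`.
Differentiation under the integral sign yields `∂m_k/∂l = -m_(k+1)` and `t ∂m_k/∂t = -(α+k+1) m_k +
l m_(k+1)`, and dominated convergence gives continuity up to `l = 0` when `t > 0`, and up to `t = 0`
when `l > 0`.

Let `L` be the moment functional, `p_n` its monic orthogonal polynomials and `h_n = L(p_n²)`.
Gram-Schmidt is rational in the moments, so `p_n` and `h_n` inherit their regularity. Along a path
of functionals, `p_n'` has degree below `n`, since the leading coefficient is constant, and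
differentiating `L(p_n p_k) = 0` gives `L(p_n' p_k) = -L'(p_n p_k)` for `k < n`. By positivity these
relations determine `p_n'` (`polyHasDerivAt_gramSchmidt`); moreover `h_n' = L'(p_n²)`.

In `l`, `L'(q) = -L(xq)`, so only `k = n-1` contributes: `p_n' = (h_n/h_(n-1)) p_(n-1)` and `h_n' =
-B_n h_n`. As `a_n = ± h_n^(-1/2)`, this gives `∂P_n/∂l = (B_n/2) P_n + A_n P_(n-1)`, a linear
equation solved with an integrating factor.

In `t`, the term `k m_k` turns `L'` into the Euler operator `x d/dx`, and `P_n/a_n = p_n` satisfies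
`t ∂p_n/∂t = x p_n' - n p_n - l (h_n/h_(n-1)) p_(n-1)`, the prime on the right being `d/dx`.
Integrating from `0` needs integrability of the right side over `t`. Each moment is decreasing in
`t` and continuous at `0`, so its derivative is integrable, and `∂p_n/∂t` is a combination of such
derivatives with continuous coefficients. At `t = 0` the weight is a Laguerre weight, which supplies
the initial value. -/

/-! ### Monic orthogonal polynomials of a positive functional -/

/-- The linear functional on polynomials with moments `m`. -/
def momentFunctional (m : ℕ → ℝ) : ℝ[X] →ₗ[ℝ] ℝ :=
  Polynomial.lsum fun k => LinearMap.mulRight ℝ (m k)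

theorem momentFunctional_apply_of_le (m : ℕ → ℝ) {q : ℝ[X]} {N : ℕ} (h : q.natDegree ≤ N) :
    momentFunctional m q = ∑ k ∈ Finset.range (N + 1), q.coeff k * m k := by
  rw [momentFunctional, Polynomial.lsum_apply, Polynomial.sum_over_range' _ _ (N + 1) (by lia)]
  · simp
  · simp

theorem momentFunctional_X_pow (m : ℕ → ℝ) (k : ℕ) : momentFunctional m (X ^ k) = m k := by
  rw [momentFunctional_apply_of_le m (natDegree_X_pow_le k)]
  simp [coeff_X_pow]

/-- Gram-Schmidt applied to the monomials, for a linear functional on polynomials. -/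
def gramSchmidt (L : ℝ[X] →ₗ[ℝ] ℝ) (n : ℕ) : ℝ[X] :=
  X ^ n - ∑ k : Fin n, C (L (X ^ n * gramSchmidt L k) / L (gramSchmidt L k ^ 2)) * gramSchmidt L k
termination_by n
decreasing_by all_goals exact k.isLt

theorem gramSchmidt_eq (L : ℝ[X] →ₗ[ℝ] ℝ) (n : ℕ) :
    gramSchmidt L n = X ^ n - ∑ k ∈ Finset.range n,
      C (L (X ^ n * gramSchmidt L k) / L (gramSchmidt L k ^ 2)) * gramSchmidt L k := by
  rw [gramSchmidt, Finset.sum_range]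

theorem coeff_gramSchmidt (L : ℝ[X] →ₗ[ℝ] ℝ) (n : ℕ) :
    (gramSchmidt L n).coeff n = 1 ∧ ∀ k, n < k → (gramSchmidt L n).coeff k = 0 := by
  induction n using Nat.strong_induction_on with
  | _ n ih =>
    constructor
    · rw [gramSchmidt_eq, coeff_sub, finsetSum_coeff, Finset.sum_eq_zero]
      · simp
      · intro k hk
        rw [coeff_C_mul, (ih k (Finset.mem_range.1 hk)).2 n (Finset.mem_range.1 hk), mul_zero]
    · intro j hj
      rw [gramSchmidt_eq, coeff_sub, finsetSum_coeff, Finset.sum_eq_zero]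
      · simp [coeff_X_pow, hj.ne']
      · intro k hk
        rw [coeff_C_mul, (ih k (Finset.mem_range.1 hk)).2 j ((Finset.mem_range.1 hk).trans hj),
          mul_zero]

theorem natDegree_gramSchmidt (L : ℝ[X] →ₗ[ℝ] ℝ) (n : ℕ) : (gramSchmidt L n).natDegree = n :=
  natDegree_eq_of_le_of_coeff_ne_zero
    (natDegree_le_iff_coeff_eq_zero.2 (coeff_gramSchmidt L n).2)
    (by rw [(coeff_gramSchmidt L n).1]; exact one_ne_zero)

theorem gramSchmidt_ne_zero (L : ℝ[X] →ₗ[ℝ] ℝ) (n : ℕ) : gramSchmidt L n ≠ 0 := fun h => by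
  have := (coeff_gramSchmidt L n).1
  simp [h] at this

theorem degree_gramSchmidt_lt (L : ℝ[X] →ₗ[ℝ] ℝ) {k n : ℕ} (h : k < n) :
    (gramSchmidt L k).degree < n :=
  (degree_lt_iff_coeff_zero _ _).2 fun j hj => (coeff_gramSchmidt L k).2 j (by lia)

/-- A linear functional on polynomials is positive when it is positive on nonzero squares. -/
def IsPositive (L : ℝ[X] →ₗ[ℝ] ℝ) : Prop := ∀ q : ℝ[X], q ≠ 0 → 0 < L (q ^ 2)

/-- Orthogonality to the first `n` Gram-Schmidt polynomials is orthogonality to all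
polynomials of degree `< n`. -/
theorem apply_mul_eq_zero_of_degree_lt (L : ℝ[X] →ₗ[ℝ] ℝ) {r : ℝ[X]} {n : ℕ}
    (h : ∀ k < n, L (r * gramSchmidt L k) = 0) {q : ℝ[X]} (hq : q.degree < n) :
    L (r * q) = 0 := by
  induction n generalizing q with
  | zero =>
    have : q = 0 := by
      ext j; simpa using (degree_lt_iff_coeff_zero _ _).1 hq j (Nat.zero_le _)
    simp [this]
  | succ n ih =>
    -- Since the Gram-Schmidt polynomial is monic, subtracting this multiple cancels the top
    -- coefficient and lowers the degree.
    have hd : (q - q.coeff n • gramSchmidt L n).degree < n := by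
      rw [degree_lt_iff_coeff_zero]
      intro j hj
      rcases hj.eq_or_lt with rfl | hj
      · simp [(coeff_gramSchmidt L _).1]
      · have h1 := (degree_lt_iff_coeff_zero _ _).1 hq j hj
        simp [h1, (coeff_gramSchmidt L _).2 j hj]
    have h1 := ih (fun k hk => h k (by lia)) hd
    rw [mul_sub, map_sub, mul_smul_comm, map_smul, h n (by lia)] at h1
    simpa using h1

namespace IsPositive

variable {L : ℝ[X] →ₗ[ℝ] ℝ}

theorem sq_pos (hL : IsPositive L) (n : ℕ) : 0 < L (gramSchmidt L n ^ 2) :=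
  hL _ (gramSchmidt_ne_zero L n)

theorem apply_gramSchmidt_mul_of_lt (hL : IsPositive L) {n k : ℕ} (hk : k < n) :
    L (gramSchmidt L n * gramSchmidt L k) = 0 := by
  induction n using Nat.strong_induction_on generalizing k with
  | _ n ih =>
    rw [gramSchmidt_eq L n, sub_mul, map_sub, Finset.sum_mul, map_sum, Finset.sum_eq_single k]
    · rw [mul_assoc, ← smul_eq_C_mul, map_smul, ← sq, smul_eq_mul,
        div_mul_cancel₀ _ (hL.sq_pos k).ne', sub_self]
    · intro j hj hjk
      rw [mul_assoc, ← smul_eq_C_mul, map_smul]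
      rcases lt_or_gt_of_ne hjk with h | h
      · rw [mul_comm (gramSchmidt L j), ih k hk h, smul_zero]
      · rw [ih j (Finset.mem_range.1 hj) h, smul_zero]
    · intro h
      exact absurd (Finset.mem_range.2 hk) h

theorem apply_gramSchmidt_mul_of_ne (hL : IsPositive L) {n k : ℕ} (hk : n ≠ k) :
    L (gramSchmidt L n * gramSchmidt L k) = 0 := by
  rcases lt_or_gt_of_ne hk with h | h
  · rw [mul_comm, hL.apply_gramSchmidt_mul_of_lt h]
  · exact hL.apply_gramSchmidt_mul_of_lt h

theorem apply_gramSchmidt_mul (hL : IsPositive L) {n : ℕ} {q : ℝ[X]} (hq : q.degree < n) :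
    L (gramSchmidt L n * q) = 0 :=
  apply_mul_eq_zero_of_degree_lt L (fun _ hk => hL.apply_gramSchmidt_mul_of_lt hk) hq

/-- Here `r` may be tested against itself, so `L(r²) = 0`, contradicting positivity unless `r = 0`.
This is the uniqueness used to identify derivatives. -/
theorem eq_zero_of_orthogonal (hL : IsPositive L) {n : ℕ} {r : ℝ[X]} (hr : r.degree < n)
    (h : ∀ k < n, L (r * gramSchmidt L k) = 0) : r = 0 := by
  by_contra h0
  have := hL r h0
  rw [sq, apply_mul_eq_zero_of_degree_lt L h hr] at this
  exact lt_irrefl _ this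

/-- A monic polynomial orthogonal to all lower powers is the Gram-Schmidt polynomial. -/
theorem eq_gramSchmidt (hL : IsPositive L) {n : ℕ} {q : ℝ[X]} (h1 : q.coeff n = 1)
    (h2 : ∀ k, n < k → q.coeff k = 0) (h : ∀ k < n, L (q * X ^ k) = 0) :
    q = gramSchmidt L n := by
  have hd : (q - gramSchmidt L n).degree < n := by
    rw [degree_lt_iff_coeff_zero]
    intro j hj
    rcases hj.eq_or_lt with rfl | hj
    · simp [h1, (coeff_gramSchmidt L _).1]
    · simp [h2 j hj, (coeff_gramSchmidt L _).2 j hj]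
  refine sub_eq_zero.1 (hL.eq_zero_of_orthogonal hd fun k hk => ?_)
  rw [sub_mul, map_sub, hL.apply_gramSchmidt_mul_of_lt hk, sub_zero,
    as_sum_range_C_mul_X_pow (gramSchmidt L k), Finset.mul_sum, map_sum]
  refine Finset.sum_eq_zero fun j hj => ?_
  rw [natDegree_gramSchmidt] at hj
  rw [mul_left_comm, ← smul_eq_C_mul, map_smul, h j (by simp at hj; lia), smul_zero]

/-- The norm as a product with the leading power. -/
theorem apply_sq_eq (hL : IsPositive L) (n : ℕ) :
    L (gramSchmidt L n ^ 2) = L (gramSchmidt L n * X ^ n) := by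
  have hd : degree (gramSchmidt L n - X ^ n) < (n : WithBot ℕ) := by
    rw [degree_lt_iff_coeff_zero]
    intro j hj
    rcases hj.eq_or_lt with rfl | hj
    · simp [(coeff_gramSchmidt L _).1]
    · simp [coeff_X_pow, hj.ne', (coeff_gramSchmidt L _).2 j hj]
  have := hL.apply_gramSchmidt_mul hd
  rw [mul_sub, map_sub, ← sq] at this
  linarith

theorem apply_X_mul_mul_of_lt (hL : IsPositive L) {n k : ℕ} (hk : k < n) :
    L (X * (gramSchmidt L (n + 1) * gramSchmidt L k)) = 0 := by
  rw [mul_left_comm]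
  refine hL.apply_gramSchmidt_mul ((degree_lt_iff_coeff_zero _ _).2 fun j hj => ?_)
  obtain ⟨j, rfl⟩ : ∃ i, j = i + 1 := ⟨j - 1, by lia⟩
  rw [coeff_X_mul, (coeff_gramSchmidt L k).2 j (by lia)]

/-- `x p_n` and `p_(n+1)` are both monic of degree `n+1`, so their difference is orthogonal to
`p_(n+1)`. -/
theorem apply_X_mul_mul_pred (hL : IsPositive L) (n : ℕ) :
    L (X * (gramSchmidt L (n + 1) * gramSchmidt L n)) = L (gramSchmidt L (n + 1) ^ 2) := by
  have hd : degree (X * gramSchmidt L n - gramSchmidt L (n + 1)) < ((n + 1 : ℕ) : WithBot ℕ) := by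
    rw [degree_lt_iff_coeff_zero]
    intro j hj
    obtain ⟨j, rfl⟩ : ∃ i, j = i + 1 := ⟨j - 1, by lia⟩
    rw [coeff_sub, coeff_X_mul]
    rcases (Nat.le_of_succ_le_succ hj).eq_or_lt with rfl | hj
    · simp [(coeff_gramSchmidt L _).1]
    · simp [(coeff_gramSchmidt L _).2 j hj, (coeff_gramSchmidt L _).2 (j + 1) (Nat.succ_lt_succ hj)]
  have := hL.apply_gramSchmidt_mul hd
  rw [mul_sub, map_sub, ← sq] at this
  rw [mul_left_comm]
  linarith

/-- The diagonal coefficient of the three-term recurrence: comparing the two leading coefficients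
shows that `x p_(n+1) - p_(n+2) - β p_(n+1)` has degree at most `n`, hence is orthogonal to
`p_(n+1)`. -/
theorem apply_X_mul_sq (hL : IsPositive L) (n : ℕ) :
    L (X * gramSchmidt L (n + 1) ^ 2) =
      ((gramSchmidt L (n + 1)).coeff n - (gramSchmidt L (n + 2)).coeff (n + 1)) *
        L (gramSchmidt L (n + 1) ^ 2) := by
  set β := (gramSchmidt L (n + 1)).coeff n - (gramSchmidt L (n + 2)).coeff (n + 1) with hβ
  have hd : degree (X * gramSchmidt L (n + 1) - gramSchmidt L (n + 2) -
      β • gramSchmidt L (n + 1)) < ((n + 1 : ℕ) : WithBot ℕ) := by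
    rw [degree_lt_iff_coeff_zero]
    intro j hj
    obtain ⟨j, rfl⟩ : ∃ i, j = i + 1 := ⟨j - 1, by lia⟩
    rw [coeff_sub, coeff_sub, coeff_X_mul, coeff_smul]
    rcases (Nat.le_of_succ_le_succ hj).eq_or_lt with rfl | hj
    · simp [(coeff_gramSchmidt L _).1, hβ]
    · rw [(coeff_gramSchmidt L (n + 1)).2 (j + 1) (by lia)]
      rcases (Nat.succ_le_of_lt hj).eq_or_lt with h | h
      · subst h; simp [(coeff_gramSchmidt L _).1]
      · simp [(coeff_gramSchmidt L (n + 1)).2 j h, (coeff_gramSchmidt L (n + 2)).2 (j + 1)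
          (Nat.succ_lt_succ h)]
  have := hL.apply_gramSchmidt_mul hd
  rw [mul_sub, mul_sub, map_sub, map_sub, hL.apply_gramSchmidt_mul_of_ne (by lia), mul_smul_comm,
    map_smul, ← sq, mul_left_comm, ← sq, smul_eq_mul] at this
  linarith

end IsPositive

/-! ### Polynomials depending on a parameter -/

/-- A family of polynomials of bounded degree with coefficients continuous on `S`. -/
def PolyContinuousOn (p : ℝ → ℝ[X]) (S : Set ℝ) : Prop :=
  (∃ N, ∀ s, (p s).natDegree ≤ N) ∧ ∀ k, ContinuousOn (fun s => (p s).coeff k) S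

namespace PolyContinuousOn

variable {p q : ℝ → ℝ[X]} {S : Set ℝ}

theorem const (q : ℝ[X]) : PolyContinuousOn (fun _ => q) S :=
  ⟨⟨_, fun _ => le_rfl⟩, fun _ => continuousOn_const⟩

theorem mul (hp : PolyContinuousOn p S) (hq : PolyContinuousOn q S) :
    PolyContinuousOn (fun s => p s * q s) S := by
  obtain ⟨⟨N, hN⟩, hp⟩ := hp
  obtain ⟨⟨M, hM⟩, hq⟩ := hq
  refine ⟨⟨N + M, fun s => natDegree_mul_le_of_le (hN s) (hM s)⟩, fun k => ?_⟩
  simp only [coeff_mul]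
  exact continuousOn_finsetSum _ fun i _ => (hp _).mul (hq _)

theorem eval (hp : PolyContinuousOn p S) (x : ℝ) : ContinuousOn (fun s => (p s).eval x) S := by
  obtain ⟨⟨N, hN⟩, hp⟩ := hp
  simp only [fun s => eval_eq_sum_range' (Nat.lt_succ_of_le (hN s)) x]
  exact continuousOn_finsetSum _ fun i _ => (hp _).mul continuousOn_const

theorem momentFunctional {m : ℝ → ℕ → ℝ} (hm : ∀ k, ContinuousOn (fun s => m s k) S)
    (hp : PolyContinuousOn p S) :
    ContinuousOn (fun s => momentFunctional (m s) (p s)) S := by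
  obtain ⟨⟨N, hN⟩, hp⟩ := hp
  simp only [fun s => momentFunctional_apply_of_le (m s) (hN s)]
  exact continuousOn_finsetSum _ fun i _ => (hp _).mul (hm _)

theorem gramSchmidt {m : ℝ → ℕ → ℝ} (hm : ∀ k, ContinuousOn (fun s => m s k) S)
    (hpos : ∀ s ∈ S, IsPositive (PrudnikovLaguerre.momentFunctional (m s))) (n : ℕ) :
    PolyContinuousOn (fun s => gramSchmidt (PrudnikovLaguerre.momentFunctional (m s)) n) S := by
  induction n using Nat.strong_induction_on with
  | _ n ih =>
    refine ⟨⟨n, fun s => (natDegree_gramSchmidt _ n).le⟩, fun j => ?_⟩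
    simp only [gramSchmidt_eq _ n, coeff_sub, finsetSum_coeff, coeff_C_mul]
    refine continuousOn_const.sub (continuousOn_finsetSum _ fun k hk => ?_)
    have hk := ih k (Finset.mem_range.1 hk)
    refine (ContinuousOn.div (((const (X ^ n)).mul hk).momentFunctional hm) ?_ ?_).mul (hk.2 j)
    · simp only [sq]
      exact (hk.mul hk).momentFunctional hm
    · exact fun s hs => ((hpos s hs).sq_pos k).ne'

end PolyContinuousOn

/-- A family of polynomials of bounded degree with coefficientwise derivative `p'` at `s₀`. -/
def PolyHasDerivAt (p : ℝ → ℝ[X]) (p' : ℝ[X]) (s₀ : ℝ) : Prop :=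
  (∃ N, ∀ s, (p s).natDegree ≤ N) ∧ ∀ k, HasDerivAt (fun s => (p s).coeff k) (p'.coeff k) s₀

namespace PolyHasDerivAt

variable {p q : ℝ → ℝ[X]} {p' q' : ℝ[X]} {s₀ : ℝ}

theorem const (q : ℝ[X]) : PolyHasDerivAt (fun _ => q) 0 s₀ :=
  ⟨⟨_, fun _ => le_rfl⟩, fun _ => by simpa using hasDerivAt_const _ _⟩

theorem natDegree_le (hp : PolyHasDerivAt p p' s₀) {N : ℕ} (hN : ∀ s, (p s).natDegree ≤ N) :
    p'.natDegree ≤ N := by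
  refine natDegree_le_iff_coeff_eq_zero.2 fun k hk => ?_
  have h := hp.2 k
  simp only [fun s => coeff_eq_zero_of_natDegree_lt ((hN s).trans_lt hk)] at h
  exact h.unique (hasDerivAt_const _ _)

theorem mul (hp : PolyHasDerivAt p p' s₀) (hq : PolyHasDerivAt q q' s₀) :
    PolyHasDerivAt (fun s => p s * q s) (p' * q s₀ + p s₀ * q') s₀ := by
  obtain ⟨⟨N, hN⟩, hp⟩ := hp
  obtain ⟨⟨M, hM⟩, hq⟩ := hq
  refine ⟨⟨N + M, fun s => natDegree_mul_le_of_le (hN s) (hM s)⟩, fun k => ?_⟩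
  simp only [coeff_mul, coeff_add, ← Finset.sum_add_distrib]
  exact HasDerivAt.fun_sum fun i _ => (hp _).mul (hq _)

theorem eval (hp : PolyHasDerivAt p p' s₀) (x : ℝ) :
    HasDerivAt (fun s => (p s).eval x) (p'.eval x) s₀ := by
  obtain ⟨N, hN⟩ := hp.1
  simp only [fun s => eval_eq_sum_range' (Nat.lt_succ_of_le (hN s)) x,
    eval_eq_sum_range' (Nat.lt_succ_of_le (hp.natDegree_le hN)) x]
  exact HasDerivAt.fun_sum fun i _ => (hp.2 _).mul_const _

theorem momentFunctional {m : ℝ → ℕ → ℝ} {m' : ℕ → ℝ}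
    (hm : ∀ k, HasDerivAt (fun s => m s k) (m' k) s₀) (hp : PolyHasDerivAt p p' s₀) :
    HasDerivAt (fun s => momentFunctional (m s) (p s))
      (momentFunctional (m s₀) p' + momentFunctional m' (p s₀)) s₀ := by
  obtain ⟨N, hN⟩ := hp.1
  simp only [fun s => momentFunctional_apply_of_le (m s) (hN s),
    momentFunctional_apply_of_le _ (hN s₀),
    momentFunctional_apply_of_le _ (hp.natDegree_le hN), ← Finset.sum_add_distrib]
  exact HasDerivAt.fun_sum fun i _ => (hp.2 _).mul (hm _)

/-- Only differentiability is extracted from the recursion, whose denominators are nonzero by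
positivity at `s₀`. The useful form of the derivative comes later, from orthogonality. -/
theorem exists_gramSchmidt {m : ℝ → ℕ → ℝ} {m' : ℕ → ℝ}
    (hm : ∀ k, HasDerivAt (fun s => m s k) (m' k) s₀)
    (hpos : IsPositive (PrudnikovLaguerre.momentFunctional (m s₀))) (n : ℕ) :
    ∃ p', PolyHasDerivAt
      (fun s => gramSchmidt (PrudnikovLaguerre.momentFunctional (m s)) n) p' s₀ := by
  induction n using Nat.strong_induction_on with
  | _ n ih =>
    choose! r hr using ih
    -- The bound on `k` is placed inside the existential so that `choose` returns a total function
    -- of `k`.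
    have key : ∀ k, ∃ c : ℝ, k < n → HasDerivAt (fun s =>
        PrudnikovLaguerre.momentFunctional (m s)
          (X ^ n * gramSchmidt (PrudnikovLaguerre.momentFunctional (m s)) k) /
        PrudnikovLaguerre.momentFunctional (m s)
          (gramSchmidt (PrudnikovLaguerre.momentFunctional (m s)) k ^ 2)) c s₀ := by
      intro k
      by_cases hk : k < n
      · have h0 := (hpos.sq_pos k).ne'
        simp only [sq] at h0 ⊢
        exact ⟨_, fun _ => HasDerivAt.fun_div (((const (X ^ n)).mul (hr k hk)).momentFunctional hm)
          (((hr k hk).mul (hr k hk)).momentFunctional hm) h0⟩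
      · exact ⟨0, fun h => absurd h hk⟩
    choose c hc using key
    refine ⟨- ∑ k ∈ Finset.range n, (C (c k) * gramSchmidt
        (PrudnikovLaguerre.momentFunctional (m s₀)) k +
        C (PrudnikovLaguerre.momentFunctional (m s₀)
          (X ^ n * gramSchmidt (PrudnikovLaguerre.momentFunctional (m s₀)) k) /
        PrudnikovLaguerre.momentFunctional (m s₀)
          (gramSchmidt (PrudnikovLaguerre.momentFunctional (m s₀)) k ^ 2)) * r k),
      ⟨n, fun s => (natDegree_gramSchmidt _ n).le⟩, fun j => ?_⟩
    simp only [gramSchmidt_eq _ n, coeff_sub, finsetSum_coeff, coeff_C_mul, coeff_neg, coeff_add]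
    refine HasDerivAt.const_sub _ (HasDerivAt.fun_sum fun k hk => ?_)
    rw [Finset.mem_range] at hk
    exact (hc k hk).mul ((hr k hk).2 j)

end PolyHasDerivAt

/-! ### Derivatives along a path of positive functionals -/

section Derivative

variable {m : ℝ → ℕ → ℝ} {m' : ℕ → ℝ} {s₀ : ℝ}

/-- The derivative of the monic orthogonal polynomials along a path of moment functionals. -/
theorem exists_deriv_gramSchmidt (hm : ∀ k, HasDerivAt (fun s => m s k) (m' k) s₀)
    (hpos : ∀ᶠ s in 𝓝 s₀, IsPositive (momentFunctional (m s))) (n : ℕ) :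
    ∃ p' : ℝ[X], PolyHasDerivAt (fun s => gramSchmidt (momentFunctional (m s)) n) p' s₀ ∧
      p'.degree < n ∧ ∀ k < n, momentFunctional (m s₀)
        (p' * gramSchmidt (momentFunctional (m s₀)) k) = - momentFunctional m'
        (gramSchmidt (momentFunctional (m s₀)) n * gramSchmidt (momentFunctional (m s₀)) k) := by
  choose r hr using PolyHasDerivAt.exists_gramSchmidt hm hpos.self_of_nhds
  have hdeg : ∀ n, (r n).degree < n := by
    intro n
    rw [degree_lt_iff_coeff_zero]
    intro j hj
    have h := (hr n).2 j
    rcases hj.eq_or_lt with rfl | hj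
    · simp only [(coeff_gramSchmidt _ _).1] at h
      exact h.unique (hasDerivAt_const _ _)
    · simp only [(coeff_gramSchmidt _ _).2 j hj] at h
      exact h.unique (hasDerivAt_const _ _)
  refine ⟨r n, hr n, hdeg n, fun k hk => ?_⟩
  have h := ((hr n).mul (hr k)).momentFunctional hm
  -- Positivity near `s₀` makes the orthogonality relation hold for all nearby `s`, so it can be
  -- differentiated; the term containing the derivative of `p_k` then drops out by degree.
  have h0 : HasDerivAt (fun s => momentFunctional (m s)
      (gramSchmidt (momentFunctional (m s)) n * gramSchmidt (momentFunctional (m s)) k)) 0 s₀ :=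
    (hasDerivAt_const s₀ (0 : ℝ)).congr_of_eventuallyEq
      (hpos.mono fun s hs => hs.apply_gramSchmidt_mul_of_lt hk)
  have h1 := h.unique h0
  rw [map_add, hpos.self_of_nhds.apply_gramSchmidt_mul
    ((hdeg k).trans (by exact_mod_cast hk))] at h1
  linarith

/-- The terms from differentiating `p_n` vanish: its derivative has degree below `n`, hence is
orthogonal to `p_n`. Only the change of the functional remains. -/
theorem hasDerivAt_apply_sq (hm : ∀ k, HasDerivAt (fun s => m s k) (m' k) s₀)
    (hpos : ∀ᶠ s in 𝓝 s₀, IsPositive (momentFunctional (m s))) (n : ℕ) :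
    HasDerivAt (fun s => momentFunctional (m s) (gramSchmidt (momentFunctional (m s)) n ^ 2))
      (momentFunctional m' (gramSchmidt (momentFunctional (m s₀)) n ^ 2)) s₀ := by
  obtain ⟨r, hr, hd, -⟩ := exists_deriv_gramSchmidt hm hpos n
  have h := (hr.mul hr).momentFunctional hm
  rw [mul_comm r, map_add, hpos.self_of_nhds.apply_gramSchmidt_mul hd] at h
  simpa [sq] using h

/-- The derivative is the candidate that solves the differentiated orthogonality relations. -/
theorem polyHasDerivAt_gramSchmidt (hm : ∀ k, HasDerivAt (fun s => m s k) (m' k) s₀)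
    (hpos : ∀ᶠ s in 𝓝 s₀, IsPositive (momentFunctional (m s))) (n : ℕ) {r : ℝ[X]}
    (hd : r.degree < n) (h : ∀ k < n, momentFunctional (m s₀)
        (r * gramSchmidt (momentFunctional (m s₀)) k) = - momentFunctional m'
        (gramSchmidt (momentFunctional (m s₀)) n * gramSchmidt (momentFunctional (m s₀)) k)) :
    PolyHasDerivAt (fun s => gramSchmidt (momentFunctional (m s)) n) r s₀ := by
  obtain ⟨p', hp, hd', h'⟩ := exists_deriv_gramSchmidt hm hpos n
  have : p' - r = 0 := hpos.self_of_nhds.eq_zero_of_orthogonal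
    ((degree_sub_le _ _).trans_lt (max_lt hd' hd)) fun k hk => by
      rw [sub_mul, map_sub, h' k hk, h k hk, sub_self]
  rwa [← sub_eq_zero.1 this]

/-- The expansion of the derivative in the orthogonal polynomials. -/
theorem polyHasDerivAt_gramSchmidt_sum (hm : ∀ k, HasDerivAt (fun s => m s k) (m' k) s₀)
    (hpos : ∀ᶠ s in 𝓝 s₀, IsPositive (momentFunctional (m s))) (n : ℕ) :
    PolyHasDerivAt (fun s => gramSchmidt (momentFunctional (m s)) n)
      (∑ k ∈ Finset.range n, (- momentFunctional m' (gramSchmidt (momentFunctional (m s₀)) n *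
          gramSchmidt (momentFunctional (m s₀)) k) /
        momentFunctional (m s₀) (gramSchmidt (momentFunctional (m s₀)) k ^ 2)) •
        gramSchmidt (momentFunctional (m s₀)) k) s₀ := by
  have hp := hpos.self_of_nhds
  refine polyHasDerivAt_gramSchmidt hm hpos n ?_ fun k hk => ?_
  · rw [degree_lt_iff_coeff_zero]
    intro j hj
    rw [finsetSum_coeff]
    refine Finset.sum_eq_zero fun k hk => ?_
    rw [coeff_smul, (coeff_gramSchmidt _ k).2 j ((Finset.mem_range.1 hk).trans_le hj), smul_zero]
  · rw [Finset.sum_mul, map_sum, Finset.sum_eq_single k]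
    · rw [smul_mul_assoc, map_smul, ← sq, smul_eq_mul, div_mul_cancel₀ _ (hp.sq_pos k).ne']
    · intro j _ hj
      rw [smul_mul_assoc, map_smul, hp.apply_gramSchmidt_mul_of_ne hj, smul_zero]
    · intro h
      exact absurd (Finset.mem_range.2 hk) h

end Derivative

/-! ### Integral representation of `ρ_ν` and moments of the weight -/

theorem integrableOn_rpow_mul_exp_neg_mul {s b : ℝ} (hs : -1 < s) (hb : 0 < b) :
    IntegrableOn (fun x : ℝ => x ^ s * Real.exp (-b * x)) (Set.Ioi 0) := by
  simpa using integrableOn_rpow_mul_exp_neg_mul_rpow hs one_pos hb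

theorem integrableOn_rpow_mul_exp_neg {s : ℝ} (hs : -1 < s) :
    IntegrableOn (fun x : ℝ => x ^ s * Real.exp (-x)) (Set.Ioi 0) := by
  simpa using integrableOn_rpow_mul_exp_neg_mul hs one_pos

theorem integrableOn_rho_kernel {ν x : ℝ} (hν : 0 < ν) (hx : 0 ≤ x) :
    IntegrableOn (fun u : ℝ => u ^ (ν - 1) * Real.exp (-u - x / u)) (Set.Ioi 0) := by
  refine Integrable.mono' (integrableOn_rpow_mul_exp_neg (s := ν - 1) (by linarith))
    (by fun_prop) ?_
  filter_upwards [self_mem_ae_restrict measurableSet_Ioi] with u hu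
  have hu : 0 < u := hu
  rw [Real.norm_of_nonneg (by positivity)]
  gcongr
  have : 0 ≤ x / u := by positivity
  linarith

/-- The representation `ρ_ν(x) = ∫_0^∞ u^{ν-1} e^{-u-x/u} du`. -/
theorem rho_eq_integral {ν x : ℝ} (hν : 0 < ν) (hx : 0 ≤ x) :
    rho ν x = ∫ u in Set.Ioi (0 : ℝ), u ^ (ν - 1) * Real.exp (-u - x / u) := by
  rcases hx.eq_or_lt with rfl | hx
  · rw [rho, if_pos rfl, Real.Gamma_eq_integral hν]
    simp [mul_comm]
  rw [rho, if_neg hx.ne']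
  have hr : 0 < Real.sqrt x := Real.sqrt_pos.2 hx
  -- The substitution `u = √x e^s` symmetrizes the exponent: `u + x/u = 2 √x cosh s`.
  have himg : (fun s => Real.sqrt x * Real.exp s) '' Set.univ = Set.Ioi 0 := by
    ext u
    simp only [Set.image_univ, Set.mem_range, Set.mem_Ioi]
    constructor
    · rintro ⟨s, rfl⟩; positivity
    · intro hu
      exact ⟨Real.log (u / Real.sqrt x), by rw [Real.exp_log (by positivity)]; field_simp⟩
  have hder : ∀ s ∈ (Set.univ : Set ℝ), HasDerivWithinAt (fun s => Real.sqrt x * Real.exp s)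
      (Real.sqrt x * Real.exp s) Set.univ s :=
    fun s _ => ((Real.hasDerivAt_exp s).const_mul _).hasDerivWithinAt
  have hinj : Set.InjOn (fun s => Real.sqrt x * Real.exp s) Set.univ := by
    intro s _ s' _ h
    exact Real.exp_injective (mul_left_cancel₀ hr.ne' h)
  have hfun : ∀ s : ℝ, |Real.sqrt x * Real.exp s| • ((Real.sqrt x * Real.exp s) ^ (ν - 1) *
      Real.exp (-(Real.sqrt x * Real.exp s) - x / (Real.sqrt x * Real.exp s))) =
      x ^ (ν / 2) * Real.exp (-(2 * Real.sqrt x) * Real.cosh s + ν * s) := by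
    intro s
    have h1 : 0 < Real.sqrt x * Real.exp s := by positivity
    rw [abs_of_pos h1, smul_eq_mul, ← mul_assoc, mul_comm (Real.sqrt x * Real.exp s),
      ← Real.rpow_add_one h1.ne', sub_add_cancel, Real.mul_rpow hr.le (Real.exp_pos s).le,
      Real.sqrt_eq_rpow, ← Real.rpow_mul hx.le, ← Real.exp_mul, ← Real.sqrt_eq_rpow, mul_assoc,
      ← Real.exp_add]
    have h2 : x / (Real.sqrt x * Real.exp s) = Real.sqrt x * Real.exp (-s) := by
      rw [Real.exp_neg]
      field_simp
      exact (Real.sq_sqrt hx.le).symm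
    rw [h2, Real.cosh_eq]
    ring_nf
  have hI := (integrableOn_image_iff_integrableOn_abs_deriv_smul MeasurableSet.univ hder hinj
    fun u => u ^ (ν - 1) * Real.exp (-u - x / u)).1 (by
      rw [himg]; exact integrableOn_rho_kernel hν hx.le)
  simp only [hfun] at hI
  rw [integrableOn_univ] at hI
  have hE := integral_image_eq_integral_abs_deriv_smul MeasurableSet.univ hder hinj
    fun u => u ^ (ν - 1) * Real.exp (-u - x / u)
  simp only [hfun] at hE
  rw [himg, Measure.restrict_univ] at hE
  have hI' : Integrable fun s : ℝ => Real.exp (-(2 * Real.sqrt x) * Real.cosh s + ν * s) := by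
    have := hI.const_mul (x ^ (ν / 2))⁻¹
    simpa [← mul_assoc, inv_mul_cancel₀ (Real.rpow_pos_of_pos hx (ν / 2)).ne'] using this
  rw [hE, integral_const_mul, mul_comm 2, mul_assoc]
  congr 1
  -- Folding the line at `0` pairs `e^(νs)` with `e^(-νs)`, which gives `2 cosh (νs)`.
  rw [← intervalIntegral.integral_Iic_add_Ioi hI'.integrableOn (b := 0) hI'.integrableOn,
    ← neg_zero, ← integral_comp_neg_Ioi, neg_zero, ← integral_add, macdonaldK,
    ← integral_const_mul]
  · refine integral_congr_ae (Eventually.of_forall fun s => ?_)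
    simp only [Real.cosh_neg, Real.exp_add, ← mul_add]
    rw [Real.cosh_eq (ν * s)]
    ring_nf
  · exact hI'.comp_neg.integrableOn
  · exact hI'.integrableOn

/-- The integral `∫_0^∞ u^{ν-1} e^{-u} (l + t/u)^{-s} du`, which is `1/Γ(s)` times the Mellin
transform at `s` of `e^{-lx} ρ_ν(xt)`. -/
def mellinRho (ν l t s : ℝ) : ℝ :=
  ∫ u in Set.Ioi (0 : ℝ), u ^ (ν - 1) * Real.exp (-u) * (l + t / u) ^ (-s)

/-- The moments of the weight. -/
def moment (α ν l t : ℝ) (k : ℕ) : ℝ :=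
  Real.Gamma (α + k + 1) * mellinRho ν l t (α + k + 1)

theorem kernel_pos {l t u : ℝ} (hl : 0 ≤ l) (ht : 0 ≤ t) (hlt : l ^ 2 + t ^ 2 ≠ 0) (hu : 0 < u) :
    0 < l + t / u := by
  rcases hl.eq_or_lt with rfl | hl
  · have : 0 < t := lt_of_le_of_ne ht (by rintro rfl; simp at hlt)
    positivity
  · positivity

/-- Dropping `l` gives a majorant uniform in `l ≥ 0`, which allows the endpoint `l = 0`. The
companion bound drops `t/u` instead and is uniform in `t ≥ 0`. -/
theorem integrableOn_kernel_of_pos_right {ν l t s : ℝ} (hν : 0 < ν) (hl : 0 ≤ l) (ht : 0 < t)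
    (hs : 0 ≤ s) :
    IntegrableOn (fun u : ℝ => t ^ (-s) * (u ^ (ν - 1 + s) * Real.exp (-u))) (Set.Ioi 0) ∧
    ∀ u : ℝ, 0 < u → ‖u ^ (ν - 1) * Real.exp (-u) * (l + t / u) ^ (-s)‖ ≤
      t ^ (-s) * (u ^ (ν - 1 + s) * Real.exp (-u)) := by
  refine ⟨(integrableOn_rpow_mul_exp_neg (by linarith)).const_mul _, fun u hu => ?_⟩
  rw [Real.norm_of_nonneg (by positivity)]
  have h1 : (l + t / u) ^ (-s) ≤ (t / u) ^ (-s) :=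
    Real.rpow_le_rpow_of_nonpos (by positivity) (by linarith) (by linarith)
  have h2 : (t / u) ^ (-s) = t ^ (-s) * u ^ s := by
    rw [Real.div_rpow ht.le hu.le, Real.rpow_neg hu.le, div_inv_eq_mul]
  rw [h2] at h1
  calc _ ≤ u ^ (ν - 1) * Real.exp (-u) * (t ^ (-s) * u ^ s) := by gcongr
    _ = _ := by rw [Real.rpow_add hu]; ring

theorem integrableOn_kernel_of_pos_left {ν l t s : ℝ} (hν : 0 < ν) (hl : 0 < l) (ht : 0 ≤ t)
    (hs : 0 ≤ s) :
    IntegrableOn (fun u : ℝ => l ^ (-s) * (u ^ (ν - 1) * Real.exp (-u))) (Set.Ioi 0) ∧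
    ∀ u : ℝ, 0 < u → ‖u ^ (ν - 1) * Real.exp (-u) * (l + t / u) ^ (-s)‖ ≤
      l ^ (-s) * (u ^ (ν - 1) * Real.exp (-u)) := by
  refine ⟨(integrableOn_rpow_mul_exp_neg (by linarith)).const_mul _, fun u hu => ?_⟩
  rw [Real.norm_of_nonneg (by positivity), mul_comm]
  have h1 : (l + t / u) ^ (-s) ≤ l ^ (-s) :=
    Real.rpow_le_rpow_of_nonpos hl (le_add_of_nonneg_right (by positivity)) (by linarith)
  gcongr

theorem integrableOn_kernel {ν l t s : ℝ} (hν : 0 < ν) (hl : 0 ≤ l) (ht : 0 ≤ t)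
    (hlt : l ^ 2 + t ^ 2 ≠ 0) (hs : 0 ≤ s) :
    IntegrableOn (fun u : ℝ => u ^ (ν - 1) * Real.exp (-u) * (l + t / u) ^ (-s))
      (Set.Ioi 0) := by
  rcases ht.eq_or_lt with rfl | ht
  · have hl : 0 < l := lt_of_le_of_ne hl (by rintro rfl; simp at hlt)
    obtain ⟨h1, h2⟩ := integrableOn_kernel_of_pos_left (t := 0) hν hl le_rfl hs
    refine Integrable.mono' h1 (by fun_prop) ?_
    filter_upwards [self_mem_ae_restrict measurableSet_Ioi] with u hu using h2 u hu
  · obtain ⟨h1, h2⟩ := integrableOn_kernel_of_pos_right hν hl ht hs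
    refine Integrable.mono' h1 (by fun_prop) ?_
    filter_upwards [self_mem_ae_restrict measurableSet_Ioi] with u hu using h2 u hu

/-- The moments of the weight, by Fubini's theorem. -/
theorem integral_rpow_mul_weight {ν l t s : ℝ} (hν : 0 < ν) (hl : 0 ≤ l) (ht : 0 ≤ t)
    (hlt : l ^ 2 + t ^ 2 ≠ 0) (hs : 0 < s) :
    IntegrableOn (fun x : ℝ => x ^ (s - 1) * Real.exp (-l * x) * rho ν (x * t)) (Set.Ioi 0) ∧
    ∫ x in Set.Ioi (0 : ℝ), x ^ (s - 1) * Real.exp (-l * x) * rho ν (x * t) =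
      Real.Gamma s * mellinRho ν l t s := by
  set f : ℝ → ℝ → ℝ := fun x u =>
    x ^ (s - 1) * Real.exp (-l * x) * (u ^ (ν - 1) * Real.exp (-u - x * t / u)) with hf
  have hinner : ∀ u : ℝ, ∀ x : ℝ, f x u = u ^ (ν - 1) * Real.exp (-u) *
      (x ^ (s - 1) * Real.exp (-(l + t / u) * x)) := by
    intro u x
    simp only [hf]
    have : Real.exp (-l * x) * Real.exp (-u - x * t / u) =
        Real.exp (-u) * Real.exp (-(l + t / u) * x) := by
      rw [← Real.exp_add, ← Real.exp_add]; ring_nf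
    linear_combination x ^ (s - 1) * u ^ (ν - 1) * this
  have hval : ∀ u : ℝ, 0 < u → ∫ x in Set.Ioi (0 : ℝ), f x u =
      Real.Gamma s * (u ^ (ν - 1) * Real.exp (-u) * (l + t / u) ^ (-s)) := by
    intro u hu
    have hp := kernel_pos hl ht hlt hu
    simp only [hinner u, integral_const_mul]
    have := Real.integral_rpow_mul_exp_neg_mul_Ioi hs hp
    simp only [neg_mul]
    rw [this, one_div, Real.inv_rpow hp.le, Real.rpow_neg hp.le]
    ring
  have hnn : ∀ u x : ℝ, 0 < u → 0 < x → 0 ≤ f x u := by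
    intro u x hu hx
    simp only [hf]
    positivity
  have hprod : Integrable (Function.uncurry f)
      ((volume.restrict (Set.Ioi 0)).prod (volume.restrict (Set.Ioi 0))) := by
    -- The integrand is nonnegative and its `x`-integral is an explicit Gamma integral, so
    -- integrability on the product reduces to `integrableOn_kernel`.
    rw [integrable_prod_iff' (by
      refine Measurable.aestronglyMeasurable ?_
      simp only [hf, Function.uncurry_def]
      fun_prop)]
    constructor
    · filter_upwards [self_mem_ae_restrict measurableSet_Ioi] with u hu
      simp only [Function.uncurry_apply_pair, hinner u]
      exact (integrableOn_rpow_mul_exp_neg_mul (by linarith) (kernel_pos hl ht hlt hu)).const_mul _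
    · refine ((integrableOn_kernel hν hl ht hlt hs.le).const_mul (Real.Gamma s)).congr ?_
      filter_upwards [self_mem_ae_restrict measurableSet_Ioi] with u hu
      rw [← hval u hu]
      refine setIntegral_congr_fun measurableSet_Ioi fun x hx => ?_
      exact (Real.norm_of_nonneg (hnn u x hu hx)).symm
  have hrho : ∀ x ∈ Set.Ioi (0 : ℝ), ∫ u in Set.Ioi (0 : ℝ), f x u =
      x ^ (s - 1) * Real.exp (-l * x) * rho ν (x * t) := by
    intro x hx
    rw [rho_eq_integral hν (mul_nonneg (le_of_lt hx) ht), ← integral_const_mul]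
  constructor
  · exact (integrableOn_congr_fun hrho measurableSet_Ioi).1 hprod.integral_prod_left
  · rw [← setIntegral_congr_fun measurableSet_Ioi hrho, integral_integral_swap hprod,
      mellinRho, ← integral_const_mul]
    exact setIntegral_congr_fun measurableSet_Ioi hval

theorem rho_pos {ν x : ℝ} (hν : 0 < ν) (hx : 0 ≤ x) : 0 < rho ν x := by
  rw [rho_eq_integral hν hx, setIntegral_pos_iff_support_of_nonneg_ae _
    (integrableOn_rho_kernel hν hx)]
  · have : Function.support (fun u : ℝ => u ^ (ν - 1) * Real.exp (-u - x / u)) ∩ Set.Ioi 0 =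
        Set.Ioi 0 := by
      refine Set.inter_eq_right.2 fun u hu => ?_
      have hu : 0 < u := hu
      exact (by positivity : (0 : ℝ) < u ^ (ν - 1) * Real.exp (-u - x / u)).ne'
    rw [this]
    simp
  · filter_upwards [self_mem_ae_restrict measurableSet_Ioi] with u hu
    have hu : 0 < u := hu
    positivity

theorem weight_pos {α ν l t x : ℝ} (hν : 0 < ν) (ht : 0 ≤ t) (hx : 0 < x) :
    0 < weight α ν l t x := by
  have := rho_pos hν (mul_nonneg hx.le ht)
  rw [weight]
  positivity

/-! ### The weight as a positive moment functional -/

section Moments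

variable {α ν l t : ℝ}

theorem integrableOn_pow_mul_weight (hα : -1 < α) (hν : 0 < ν) (hl : 0 ≤ l) (ht : 0 ≤ t)
    (hlt : l ^ 2 + t ^ 2 ≠ 0) (k : ℕ) :
    IntegrableOn (fun x : ℝ => x ^ k * weight α ν l t x) (Set.Ioi 0) ∧
    ∫ x in Set.Ioi (0 : ℝ), x ^ k * weight α ν l t x = moment α ν l t k := by
  have hk : (0 : ℝ) ≤ k := k.cast_nonneg
  have h := integral_rpow_mul_weight (s := α + k + 1) hν hl ht hlt (by linarith)
  have hc : Set.EqOn (fun x : ℝ => x ^ (α + k + 1 - 1) * Real.exp (-l * x) * rho ν (x * t))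
      (fun x : ℝ => x ^ k * weight α ν l t x) (Set.Ioi 0) := by
    intro x hx
    simp only [weight, add_sub_cancel_right]
    rw [Real.rpow_add hx, Real.rpow_natCast]
    ring
  exact ⟨(integrableOn_congr_fun hc measurableSet_Ioi).1 h.1,
    (setIntegral_congr_fun measurableSet_Ioi hc).symm.trans h.2⟩

theorem functional_eq (hα : -1 < α) (hν : 0 < ν) (hl : 0 ≤ l) (ht : 0 ≤ t)
    (hlt : l ^ 2 + t ^ 2 ≠ 0) (q : ℝ[X]) :
    IntegrableOn (fun x : ℝ => q.eval x * weight α ν l t x) (Set.Ioi 0) ∧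
    functional α ν l t q = momentFunctional (moment α ν l t) q := by
  have h := integrableOn_pow_mul_weight hα hν hl ht hlt
  have hI : ∀ k ∈ Finset.range (q.natDegree + 1), IntegrableOn
      (fun x : ℝ => q.coeff k * (x ^ k * weight α ν l t x)) (Set.Ioi 0) :=
    fun k _ => (h k).1.const_mul _
  simp only [functional, eval_eq_sum_range, Finset.sum_mul, mul_assoc]
  refine ⟨integrable_finsetSum _ hI, ?_⟩
  rw [integral_finsetSum _ hI, momentFunctional_apply_of_le _ le_rfl]
  refine Finset.sum_congr rfl fun k _ => ?_
  rw [integral_const_mul, (h k).2]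

theorem isPositive_moment (hα : -1 < α) (hν : 0 < ν) (hl : 0 ≤ l) (ht : 0 ≤ t)
    (hlt : l ^ 2 + t ^ 2 ≠ 0) : IsPositive (momentFunctional (moment α ν l t)) := by
  intro q hq
  obtain ⟨hI, hE⟩ := functional_eq hα hν hl ht hlt (q ^ 2)
  rw [← hE, functional, setIntegral_pos_iff_support_of_nonneg_ae _ hI]
  · have hfin : {x : ℝ | q.IsRoot x}.Finite := Polynomial.finite_setOfPred_isRoot hq
    have hsub : Set.Ioi (0 : ℝ) \ {x : ℝ | q.IsRoot x} ⊆
        Function.support (fun x : ℝ => (q ^ 2).eval x * weight α ν l t x) ∩ Set.Ioi 0 := by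
      rintro x ⟨hx, hr⟩
      refine ⟨?_, hx⟩
      rw [Function.mem_support, eval_pow]
      exact mul_ne_zero (pow_ne_zero 2 hr) (weight_pos hν ht hx).ne'
    refine lt_of_lt_of_le ?_ (measure_mono hsub)
    rw [measure_sdiff_null (hfin.measure_zero _)]
    simp
  · filter_upwards [self_mem_ae_restrict measurableSet_Ioi] with x hx
    have := (weight_pos (α := α) (l := l) hν ht hx).le
    rw [eval_pow]
    positivity

theorem monicP_eq (hα : -1 < α) (hν : 0 < ν) (hl : 0 ≤ l) (ht : 0 ≤ t)
    (hlt : l ^ 2 + t ^ 2 ≠ 0) (n : ℕ) :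
    monicP α ν l t n = gramSchmidt (momentFunctional (moment α ν l t)) n := by
  induction n using Nat.strong_induction_on with
  | _ n ih =>
    rw [monicP, gramSchmidt]
    congr 1
    refine Finset.sum_congr rfl fun k _ => ?_
    rw [ih k k.isLt, (functional_eq hα hν hl ht hlt _).2, (functional_eq hα hν hl ht hlt _).2]

end Moments

/-! ### Dependence of the moments on the parameters -/

section Parameters

variable {α ν : ℝ}

theorem hasDerivAt_mellinRho_left {l t s : ℝ} (hν : 0 < ν) (hl : 0 < l) (ht : 0 < t)
    (hs : 0 < s) :
    HasDerivAt (fun y => mellinRho ν y t s) (-s * mellinRho ν l t (s + 1)) l := by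
  obtain ⟨hb1, hb2⟩ := integrableOn_kernel_of_pos_right (ν := ν) (l := 0) (s := s + 1) hν le_rfl ht
    (by linarith)
  have h := (hasDerivAt_integral_of_dominated_loc_of_deriv_le
    (μ := volume.restrict (Set.Ioi (0 : ℝ))) (x₀ := l) (s := Set.Ioi 0)
    (F := fun y u => u ^ (ν - 1) * Real.exp (-u) * (y + t / u) ^ (-s))
    (F' := fun y u => -s * (u ^ (ν - 1) * Real.exp (-u) * (y + t / u) ^ (-(s + 1))))
    (bound := fun u => s * (t ^ (-(s + 1)) * (u ^ (ν - 1 + (s + 1)) * Real.exp (-u))))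
    (Ioi_mem_nhds hl) ?_ ?_ ?_ ?_ ?_ ?_).2
  · rw [integral_const_mul] at h
    exact h
  · exact Eventually.of_forall fun y => by fun_prop
  · exact integrableOn_kernel hν hl.le ht.le (by positivity) hs.le
  · fun_prop
  · filter_upwards [self_mem_ae_restrict measurableSet_Ioi] with u hu y hy
    have := (integrableOn_kernel_of_pos_right (l := y) (s := s + 1) hν (le_of_lt hy) ht
      (by linarith)).2 u hu
    rw [norm_mul, norm_neg, Real.norm_of_nonneg hs.le]
    gcongr
  · exact hb1.const_mul s
  · filter_upwards [self_mem_ae_restrict measurableSet_Ioi] with u hu y hy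
    have hu : 0 < u := hu
    have hy : 0 < y := hy
    have h1 : HasDerivAt (fun y => (y + t / u) ^ (-s)) _ y :=
      ((hasDerivAt_id y).add_const (t / u)).rpow_const (Or.inl (by simp only [id]; positivity))
    refine (h1.const_mul (u ^ (ν - 1) * Real.exp (-u))).congr_deriv ?_
    simp only [id, show -s - 1 = -(s + 1) by ring]
    ring

/-- The derivative in `t`, and the identity that expresses it by moments. -/
theorem hasDerivAt_mellinRho_right {l t s : ℝ} (hν : 0 < ν) (hl : 0 < l) (ht : 0 < t)
    (hs : 0 < s) :
    ∃ d : ℝ, HasDerivAt (fun y => mellinRho ν l y s) d t ∧ d ≤ 0 ∧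
      t * d = -s * mellinRho ν l t s + s * l * mellinRho ν l t (s + 1) := by
  have ht2 : 0 < t / 2 := by positivity
  have hb1 := (integrableOn_rpow_mul_exp_neg (s := ν - 1 + s) (by linarith)).const_mul
    (s * (t / 2) ^ (-(s + 1)))
  have h := (hasDerivAt_integral_of_dominated_loc_of_deriv_le
    (μ := volume.restrict (Set.Ioi (0 : ℝ))) (x₀ := t) (s := Set.Ioi (t / 2))
    (F := fun y u => u ^ (ν - 1) * Real.exp (-u) * (l + y / u) ^ (-s))
    (F' := fun y u => -s * (u ^ (ν - 1) * Real.exp (-u) * (l + y / u) ^ (-(s + 1))) / u)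
    (bound := fun u => s * (t / 2) ^ (-(s + 1)) * (u ^ (ν - 1 + s) * Real.exp (-u)))
    (Ioi_mem_nhds (by linarith)) ?_ ?_ ?_ ?_ ?_ ?_).2
  · refine ⟨_, h, ?_, ?_⟩
    · refine setIntegral_nonpos measurableSet_Ioi fun u hu => ?_
      have hu : 0 < u := hu
      rw [neg_mul, neg_div, neg_nonpos]
      positivity
    · have hlt : l ^ 2 + t ^ 2 ≠ 0 := by positivity
      rw [mellinRho, mellinRho, ← integral_const_mul, ← integral_const_mul, ← integral_const_mul,
        ← integral_add ((integrableOn_kernel hν hl.le ht.le hlt hs.le).const_mul _)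
        ((integrableOn_kernel hν hl.le ht.le hlt (by linarith)).const_mul _)]
      refine setIntegral_congr_fun measurableSet_Ioi fun u hu => ?_
      have hu : 0 < u := hu
      have hp : 0 < l + t / u := by positivity
      -- The identity is `t/u = (l + t/u) - l` under the integral sign, so no integration by parts
      -- is needed.
      have : (l + t / u) ^ (-s) = (l + t / u) * (l + t / u) ^ (-(s + 1)) := by
        nth_rewrite 2 [← Real.rpow_one (l + t / u)]
        rw [← Real.rpow_add hp]
        ring_nf
      simp only [this]
      field_simp
      ring
  · exact Eventually.of_forall fun y => by fun_prop
  · exact integrableOn_kernel hν hl.le ht.le (by positivity) hs.le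
  · refine Measurable.aestronglyMeasurable ?_
    fun_prop
  · filter_upwards [self_mem_ae_restrict measurableSet_Ioi] with u hu y hy
    have hu : 0 < u := hu
    have hy : t / 2 < y := hy
    -- The excess of `y` over `t/2` is absorbed into the first parameter, which makes the majorant
    -- independent of `y`.
    have h1 := (integrableOn_kernel_of_pos_right (l := l + (y - t / 2) / u) (s := s + 1) hν
      (by have := sub_pos.2 hy; positivity) ht2 (by linarith)).2 u hu
    rw [show l + (y - t / 2) / u + t / 2 / u = l + y / u by ring] at h1
    rw [norm_div, norm_mul, norm_neg, Real.norm_of_nonneg hs.le, Real.norm_of_nonneg hu.le,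
      div_le_iff₀ hu]
    refine (mul_le_mul_of_nonneg_left h1 hs.le).trans_eq ?_
    rw [← add_assoc, Real.rpow_add_one hu.ne']
    ring
  · exact hb1
  · filter_upwards [self_mem_ae_restrict measurableSet_Ioi] with u hu y hy
    have hu : 0 < u := hu
    have hy : 0 < y := ht2.trans hy
    have h1 : HasDerivAt (fun y => (l + y / u) ^ (-s)) _ y :=
      (((hasDerivAt_id y).div_const u).const_add l).rpow_const
        (Or.inl (by simp only [id]; positivity))
    refine (h1.const_mul (u ^ (ν - 1) * Real.exp (-u))).congr_deriv ?_
    simp only [id, show -s - 1 = -(s + 1) by ring]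
    ring

theorem continuousOn_mellinRho_left {t s : ℝ} (hν : 0 < ν) (ht : 0 < t) (hs : 0 ≤ s) :
    ContinuousOn (fun y => mellinRho ν y t s) (Set.Ici 0) := by
  refine continuousOn_of_dominated
    (bound := fun u => t ^ (-s) * (u ^ (ν - 1 + s) * Real.exp (-u))) (fun y _ => by fun_prop)
    (fun y hy => ?_) (integrableOn_kernel_of_pos_right hν le_rfl ht hs).1 ?_
  · filter_upwards [self_mem_ae_restrict measurableSet_Ioi] with u hu
    exact (integrableOn_kernel_of_pos_right hν hy ht hs).2 u hu
  · filter_upwards [self_mem_ae_restrict measurableSet_Ioi] with u hu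
    have hu : 0 < u := hu
    refine continuousOn_const.mul (ContinuousOn.rpow_const (by fun_prop) fun y hy => Or.inl ?_)
    have hy : 0 ≤ y := hy
    positivity

theorem continuousOn_mellinRho_right {l s : ℝ} (hν : 0 < ν) (hl : 0 < l) (hs : 0 ≤ s) :
    ContinuousOn (fun y => mellinRho ν l y s) (Set.Ici 0) := by
  refine continuousOn_of_dominated
    (bound := fun u => l ^ (-s) * (u ^ (ν - 1) * Real.exp (-u))) (fun y _ => by fun_prop)
    (fun y hy => ?_) (integrableOn_kernel_of_pos_left hν hl le_rfl hs).1 ?_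
  · filter_upwards [self_mem_ae_restrict measurableSet_Ioi] with u hu
    exact (integrableOn_kernel_of_pos_left hν hl hy hs).2 u hu
  · filter_upwards [self_mem_ae_restrict measurableSet_Ioi] with u hu
    have hu : 0 < u := hu
    refine continuousOn_const.mul (ContinuousOn.rpow_const (by fun_prop) fun y hy => Or.inl ?_)
    have hy : 0 ≤ y := hy
    positivity

theorem mellinRho_zero_right {l s : ℝ} (hν : 0 < ν) :
    mellinRho ν l 0 s = Real.Gamma ν * l ^ (-s) := by
  simp only [mellinRho, zero_div, add_zero]
  rw [integral_mul_const, Real.Gamma_eq_integral hν]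
  simp only [mul_comm]

theorem hasDerivAt_moment_left {l t : ℝ} (hα : -1 < α) (hν : 0 < ν) (hl : 0 < l) (ht : 0 < t)
    (k : ℕ) : HasDerivAt (fun y => moment α ν y t k) (-moment α ν l t (k + 1)) l := by
  have hs : 0 < α + k + 1 := by have : (0 : ℝ) ≤ k := k.cast_nonneg; linarith
  refine ((hasDerivAt_mellinRho_left hν hl ht hs).const_mul _).congr_deriv ?_
  rw [moment, show α + (k + 1 : ℕ) + 1 = α + k + 1 + 1 by push_cast; ring,
    Real.Gamma_add_one hs.ne']
  ring

/-- The sign is recorded because it later yields integrability of this derivative down to `t = 0`,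
in spite of the factor `1/t`. -/
theorem hasDerivAt_moment_right {l t : ℝ} (hα : -1 < α) (hν : 0 < ν) (hl : 0 < l) (ht : 0 < t)
    (k : ℕ) : HasDerivAt (fun y => moment α ν l y k)
      ((-(α + k + 1) * moment α ν l t k + l * moment α ν l t (k + 1)) / t) t ∧
      (-(α + k + 1) * moment α ν l t k + l * moment α ν l t (k + 1)) / t ≤ 0 := by
  have hs : 0 < α + k + 1 := by have : (0 : ℝ) ≤ k := k.cast_nonneg; linarith
  obtain ⟨d, h1, h2, h3⟩ := hasDerivAt_mellinRho_right hν hl ht hs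
  have hd : (-(α + k + 1) * moment α ν l t k + l * moment α ν l t (k + 1)) / t =
      Real.Gamma (α + k + 1) * d := by
    rw [moment, moment, show α + (k + 1 : ℕ) + 1 = α + k + 1 + 1 by push_cast; ring,
      Real.Gamma_add_one hs.ne', div_eq_iff ht.ne']
    linear_combination (-Real.Gamma (α + k + 1)) * h3
  rw [hd]
  exact ⟨h1.const_mul _, mul_nonpos_of_nonneg_of_nonpos (Real.Gamma_pos_of_pos hs).le h2⟩

theorem continuousOn_moment_left {t : ℝ} (hα : -1 < α) (hν : 0 < ν) (ht : 0 < t) (k : ℕ) :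
    ContinuousOn (fun y => moment α ν y t k) (Set.Ici 0) :=
  continuousOn_const.mul (continuousOn_mellinRho_left hν ht
    (by have : (0 : ℝ) ≤ k := k.cast_nonneg; linarith))

theorem continuousOn_moment_right {l : ℝ} (hα : -1 < α) (hν : 0 < ν) (hl : 0 < l) (k : ℕ) :
    ContinuousOn (fun y => moment α ν l y k) (Set.Ici 0) :=
  continuousOn_const.mul (continuousOn_mellinRho_right hν hl
    (by have : (0 : ℝ) ≤ k := k.cast_nonneg; linarith))

end Parameters

/-! ### Orthonormal polynomials and recurrence coefficients -/

/-- The functional of the weight, given by its moments. -/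
def weightFunctional (α ν l t : ℝ) : ℝ[X] →ₗ[ℝ] ℝ := momentFunctional (moment α ν l t)

/-- The squared norm of the monic orthogonal polynomials. -/
def sqNorm (α ν l t : ℝ) (n : ℕ) : ℝ :=
  weightFunctional α ν l t (gramSchmidt (weightFunctional α ν l t) n ^ 2)

section Coefficients

variable {α ν l t : ℝ}

theorem isPositive_weightFunctional (hα : -1 < α) (hν : 0 < ν) (hl : 0 ≤ l) (ht : 0 ≤ t)
    (hlt : l ^ 2 + t ^ 2 ≠ 0) : IsPositive (weightFunctional α ν l t) :=
  isPositive_moment hα hν hl ht hlt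

theorem sqNorm_pos (hα : -1 < α) (hν : 0 < ν) (hl : 0 ≤ l) (ht : 0 ≤ t)
    (hlt : l ^ 2 + t ^ 2 ≠ 0) (n : ℕ) : 0 < sqNorm α ν l t n :=
  (isPositive_weightFunctional hα hν hl ht hlt).sq_pos n

theorem P_eq_sqNorm (hα : -1 < α) (hν : 0 < ν) (hl : 0 ≤ l) (ht : 0 ≤ t)
    (hlt : l ^ 2 + t ^ 2 ≠ 0) (n : ℕ) : P α ν l t n =
    C ((-1) ^ n / Real.sqrt (sqNorm α ν l t n)) * gramSchmidt (weightFunctional α ν l t) n := by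
  rw [P, monicP_eq hα hν hl ht hlt, (functional_eq hα hν hl ht hlt _).2]
  rfl

theorem a_eq (hα : -1 < α) (hν : 0 < ν) (hl : 0 ≤ l) (ht : 0 ≤ t)
    (hlt : l ^ 2 + t ^ 2 ≠ 0) (n : ℕ) : a α ν l t n = (-1) ^ n / Real.sqrt (sqNorm α ν l t n) := by
  rw [a, P_eq_sqNorm hα hν hl ht hlt, coeff_C_mul, (coeff_gramSchmidt _ n).1, mul_one]

theorem P_eq (hα : -1 < α) (hν : 0 < ν) (hl : 0 ≤ l) (ht : 0 ≤ t)
    (hlt : l ^ 2 + t ^ 2 ≠ 0) (n : ℕ) :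
    P α ν l t n = C (a α ν l t n) * gramSchmidt (weightFunctional α ν l t) n := by
  rw [a_eq hα hν hl ht hlt, P_eq_sqNorm hα hν hl ht hlt]

theorem a_sq (hα : -1 < α) (hν : 0 < ν) (hl : 0 ≤ l) (ht : 0 ≤ t)
    (hlt : l ^ 2 + t ^ 2 ≠ 0) (n : ℕ) : a α ν l t n ^ 2 = (sqNorm α ν l t n)⁻¹ := by
  rw [a_eq hα hν hl ht hlt, div_pow, Real.sq_sqrt (sqNorm_pos hα hν hl ht hlt n).le, ← pow_mul,
    mul_comm n, pow_mul, neg_one_sq, one_pow, one_div]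

theorem a_pos (hα : -1 < α) (hν : 0 < ν) (hl : 0 ≤ l) (ht : 0 ≤ t)
    (hlt : l ^ 2 + t ^ 2 ≠ 0) (n : ℕ) : 0 < (-1) ^ n * a α ν l t n := by
  have := sqNorm_pos hα hν hl ht hlt n
  rw [a_eq hα hν hl ht hlt, mul_div_assoc', ← pow_add, ← two_mul, pow_mul, neg_one_sq, one_pow]
  positivity

theorem a_ne_zero (hα : -1 < α) (hν : 0 < ν) (hl : 0 ≤ l) (ht : 0 ≤ t)
    (hlt : l ^ 2 + t ^ 2 ≠ 0) (n : ℕ) : a α ν l t n ≠ 0 := fun h => by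
  simpa [h] using a_pos hα hν hl ht hlt n

theorem natDegree_P (hα : -1 < α) (hν : 0 < ν) (hl : 0 ≤ l) (ht : 0 ≤ t)
    (hlt : l ^ 2 + t ^ 2 ≠ 0) (n : ℕ) : (P α ν l t n).natDegree = n := by
  rw [P_eq hα hν hl ht hlt, natDegree_C_mul (a_ne_zero hα hν hl ht hlt n),
    natDegree_gramSchmidt]

theorem B_succ_eq (hα : -1 < α) (hν : 0 < ν) (hl : 0 ≤ l) (ht : 0 ≤ t)
    (hlt : l ^ 2 + t ^ 2 ≠ 0) (n : ℕ) : B α ν l t (n + 1) =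
    (gramSchmidt (weightFunctional α ν l t) (n + 1)).coeff n -
      (gramSchmidt (weightFunctional α ν l t) (n + 2)).coeff (n + 1) := by
  have h := a_ne_zero hα hν hl ht hlt
  simp only [B, b, P_eq hα hν hl ht hlt, coeff_C_mul, mul_div_cancel_left₀ _ (h _)]

/-- Since `a_k² = 1/h_k`, one has `A_(n+1) a_n = a_n²/a_(n+1) = a_(n+1) h_(n+1)/h_n`. This
translates the monic formulas into orthonormal ones. -/
theorem A_succ_mul_eval (hα : -1 < α) (hν : 0 < ν) (hl : 0 ≤ l) (ht : 0 ≤ t)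
    (hlt : l ^ 2 + t ^ 2 ≠ 0) (n : ℕ) (x : ℝ) : A α ν l t (n + 1) * (P α ν l t n).eval x =
    a α ν l t (n + 1) * (sqNorm α ν l t (n + 1) / sqNorm α ν l t n *
      (gramSchmidt (weightFunctional α ν l t) n).eval x) := by
  have h0 := a_ne_zero hα hν hl ht hlt (n + 1)
  have h1 := a_sq hα hν hl ht hlt (n + 1)
  have h2 := a_sq hα hν hl ht hlt n
  rw [A, P_eq hα hν hl ht hlt n, eval_mul, eval_C, div_eq_mul_inv _ (sqNorm α ν l t n), ← h2,
    ← inv_inv (sqNorm α ν l t (n + 1)), ← h1]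
  field_simp

theorem orthonormal_P (hα : -1 < α) (hν : 0 < ν) (hl : 0 ≤ l) (ht : 0 ≤ t)
    (hlt : l ^ 2 + t ^ 2 ≠ 0) (m k : ℕ) :
    IntegrableOn (fun x : ℝ => (P α ν l t m).eval x * (P α ν l t k).eval x * weight α ν l t x)
      (Set.Ioi 0) ∧
    ∫ x in Set.Ioi (0 : ℝ), (P α ν l t m).eval x * (P α ν l t k).eval x * weight α ν l t x
      = if m = k then 1 else 0 := by
  obtain ⟨h1, h2⟩ := functional_eq hα hν hl ht hlt (P α ν l t m * P α ν l t k)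
  simp only [functional, eval_mul] at h1 h2
  refine ⟨h1, h2.trans ?_⟩
  have : P α ν l t m * P α ν l t k = (a α ν l t m * a α ν l t k) •
      (gramSchmidt (weightFunctional α ν l t) m * gramSchmidt (weightFunctional α ν l t) k) := by
    rw [P_eq hα hν hl ht hlt, P_eq hα hν hl ht hlt, smul_eq_C_mul, C_mul]
    ring
  rw [this, map_smul]
  split_ifs with h
  · subst h
    rw [← sq, ← sq, a_sq hα hν hl ht hlt]
    exact inv_mul_cancel₀ (sqNorm_pos hα hν hl ht hlt m).ne'
  · exact smul_eq_zero_of_right _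
      ((isPositive_weightFunctional hα hν hl ht hlt).apply_gramSchmidt_mul_of_ne h)

end Coefficients

/-! ### The equation in `l` -/

section LeftParameter

variable {α ν t : ℝ}

theorem polyContinuousOn_left (hα : -1 < α) (hν : 0 < ν) (ht : 0 < t) (n : ℕ) :
    PolyContinuousOn (fun y => gramSchmidt (weightFunctional α ν y t) n) (Set.Ici 0) :=
  PolyContinuousOn.gramSchmidt (m := fun y => moment α ν y t)
    (continuousOn_moment_left hα hν ht)
    (fun y hy => isPositive_moment hα hν hy ht.le (by positivity)) n

theorem continuousOn_a_left (hα : -1 < α) (hν : 0 < ν) (ht : 0 < t) (n : ℕ) :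
    ContinuousOn (fun y => a α ν y t n) (Set.Ici 0) := by
  have h : ContinuousOn (fun y => sqNorm α ν y t n) (Set.Ici 0) := by
    have hp := polyContinuousOn_left hα hν ht n
    simp only [sqNorm, sq]
    exact (hp.mul hp).momentFunctional (m := fun y => moment α ν y t)
      (continuousOn_moment_left hα hν ht)
  refine ContinuousOn.congr (f := fun y => (-1) ^ n / Real.sqrt (sqNorm α ν y t n))
    (continuousOn_const.div h.sqrt fun y hy => ?_) fun y hy => ?_
  · exact (Real.sqrt_pos.2 (sqNorm_pos hα hν hy ht.le (by positivity) n)).ne'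
  · exact a_eq hα hν hy ht.le (by positivity) n

theorem continuousOn_eval_P_left (hα : -1 < α) (hν : 0 < ν) (ht : 0 < t) (n : ℕ) (x : ℝ) :
    ContinuousOn (fun y => (P α ν y t n).eval x) (Set.Ici 0) := by
  refine ((continuousOn_a_left hα hν ht n).mul
    ((polyContinuousOn_left hα hν ht n).eval x)).congr fun y hy => ?_
  simp only [P_eq hα hν hy ht.le (by positivity : y ^ 2 + t ^ 2 ≠ 0), eval_mul, eval_C,
    Pi.mul_apply]

theorem continuousOn_A_succ_left (hα : -1 < α) (hν : 0 < ν) (ht : 0 < t) (n : ℕ) :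
    ContinuousOn (fun y => A α ν y t (n + 1)) (Set.Ici 0) :=
  (continuousOn_a_left hα hν ht n).div (continuousOn_a_left hα hν ht (n + 1)) fun _ hy =>
    a_ne_zero hα hν hy ht.le (by positivity) _

theorem continuousOn_B_succ_left (hα : -1 < α) (hν : 0 < ν) (ht : 0 < t) (n : ℕ) :
    ContinuousOn (fun y => B α ν y t (n + 1)) (Set.Ici 0) :=
  (((polyContinuousOn_left hα hν ht (n + 1)).2 n).sub
    ((polyContinuousOn_left hα hν ht (n + 2)).2 (n + 1))).congr fun _ hy =>
      B_succ_eq hα hν hy ht.le (by positivity) n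

theorem momentFunctional_neg_shift (m : ℕ → ℝ) (q : ℝ[X]) :
    momentFunctional (fun k => -m (k + 1)) q = -momentFunctional m (X * q) := by
  induction q using Polynomial.induction_on' with
  | add p q hp hq => rw [map_add, hp, hq, mul_add, map_add, neg_add]
  | monomial k c =>
    rw [X_mul_monomial, ← smul_X_eq_monomial, ← smul_X_eq_monomial, map_smul, map_smul,
      momentFunctional_X_pow, momentFunctional_X_pow, smul_neg]

variable {l : ℝ}

/-- The derivative must pair with `p_k` to `L(x p_(n+1) p_k)`, which is `0` for `k < n` and
`h_(n+1)` for `k = n`. -/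
theorem polyHasDerivAt_left (hα : -1 < α) (hν : 0 < ν) (hl : 0 < l) (ht : 0 < t) (n : ℕ) :
    PolyHasDerivAt (fun y => gramSchmidt (weightFunctional α ν y t) (n + 1))
      ((sqNorm α ν l t (n + 1) / sqNorm α ν l t n) • gramSchmidt (weightFunctional α ν l t) n)
      l := by
  have hlt : l ^ 2 + t ^ 2 ≠ 0 := by positivity
  have hp := isPositive_weightFunctional hα hν hl.le ht.le hlt
  refine polyHasDerivAt_gramSchmidt (m := fun y => moment α ν y t)
    (m' := fun k => -moment α ν l t (k + 1)) (hasDerivAt_moment_left hα hν hl ht)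
    ?_ (n + 1) ?_ fun k hk => ?_
  · filter_upwards [Ioi_mem_nhds hl] with y hy
    exact isPositive_moment hα hν (le_of_lt hy) ht.le (by positivity)
  · exact (degree_smul_le _ _).trans_lt (degree_gramSchmidt_lt _ (Nat.lt_succ_self n))
  · rw [momentFunctional_neg_shift, neg_neg, smul_mul_assoc, map_smul]
    rcases (Nat.le_of_lt_succ hk).eq_or_lt with rfl | hk
    · refine Eq.trans ?_ (hp.apply_X_mul_mul_pred k).symm
      rw [smul_eq_mul]
      exact (congrArg _ (congrArg _ (sq _).symm)).trans
        (div_mul_cancel₀ _ (sqNorm_pos hα hν hl.le ht.le hlt k).ne')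
    · exact (smul_eq_zero_of_right _ (hp.apply_gramSchmidt_mul_of_lt hk)).trans
        (hp.apply_X_mul_mul_of_lt hk).symm

theorem hasDerivAt_a_left (hα : -1 < α) (hν : 0 < ν) (hl : 0 < l) (ht : 0 < t) (n : ℕ) :
    HasDerivAt (fun y => a α ν y t (n + 1)) (B α ν l t (n + 1) / 2 * a α ν l t (n + 1)) l := by
  have hlt : l ^ 2 + t ^ 2 ≠ 0 := by positivity
  have hp := isPositive_weightFunctional hα hν hl.le ht.le hlt
  have hh := sqNorm_pos hα hν hl.le ht.le hlt (n + 1)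
  have h : HasDerivAt (fun y => sqNorm α ν y t (n + 1))
      (-(B α ν l t (n + 1) * sqNorm α ν l t (n + 1))) l := by
    refine (hasDerivAt_apply_sq (m := fun y => moment α ν y t)
      (m' := fun k => -moment α ν l t (k + 1)) (hasDerivAt_moment_left hα hν hl ht)
      ?_ (n + 1)).congr_deriv ?_
    · filter_upwards [Ioi_mem_nhds hl] with y hy
      exact isPositive_moment hα hν (le_of_lt hy) ht.le (by positivity)
    · rw [momentFunctional_neg_shift, B_succ_eq hα hν hl.le ht.le hlt]
      exact congrArg _ (hp.apply_X_mul_sq n)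
  have h2 := (hasDerivAt_const l ((-1 : ℝ) ^ (n + 1))).fun_div (h.sqrt hh.ne')
    (Real.sqrt_pos.2 hh).ne'
  refine (h2.congr_of_eventuallyEq ?_).congr_deriv ?_
  · filter_upwards [Ioi_mem_nhds hl] with y hy
    exact a_eq hα hν (le_of_lt hy) ht.le (by positivity) (n + 1)
  · rw [a_eq hα hν hl.le ht.le hlt, Real.sq_sqrt hh.le]
    have := (Real.sqrt_pos.2 hh).ne'
    have := hh.ne'
    field_simp
    ring

/-- The differential-difference equation in the first parameter. -/
theorem hasDerivAt_eval_P_left (hα : -1 < α) (hν : 0 < ν) (hl : 0 < l) (ht : 0 < t) (n : ℕ)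
    (x : ℝ) :
    HasDerivAt (fun y => (P α ν y t (n + 1)).eval x)
      (B α ν l t (n + 1) / 2 * (P α ν l t (n + 1)).eval x +
        A α ν l t (n + 1) * (P α ν l t n).eval x) l := by
  have hlt : l ^ 2 + t ^ 2 ≠ 0 := by positivity
  have h := (hasDerivAt_a_left hα hν hl ht n).mul ((polyHasDerivAt_left hα hν hl ht n).eval x)
  refine (h.congr_of_eventuallyEq ?_).congr_deriv ?_
  · filter_upwards [Ioi_mem_nhds hl] with y hy
    simp only [P_eq hα hν (le_of_lt hy) ht.le (by positivity : y ^ 2 + t ^ 2 ≠ 0), eval_mul,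
      eval_C, Pi.mul_apply]
  · rw [A_succ_mul_eval hα hν hl.le ht.le hlt, P_eq hα hν hl.le ht.le hlt (n + 1)]
    simp only [eval_mul, eval_C, eval_smul, smul_eq_mul]
    ring

/-- With the integrating factor `exp(½ ∫_ξ^l B)`, the `B` terms cancel in the derivative of the
product with `P_(n+1)`. The derivative is needed only for `0 < ξ < l`; continuity covers the
endpoints. -/
theorem integral_equation_left (hα : -1 < α) (hν : 0 < ν) (hl : 0 ≤ l) (ht : 0 < t) (n : ℕ) :
    IntervalIntegrable (fun y : ℝ => B α ν y t (n + 1)) volume 0 l ∧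
      ∀ x : ℝ,
        IntervalIntegrable (fun ξ : ℝ => Real.exp (1 / 2 * ∫ y in ξ..l, B α ν y t (n + 1)) *
            A α ν ξ t (n + 1) * (P α ν ξ t n).eval x) volume 0 l ∧
        (P α ν l t (n + 1)).eval x =
          (∫ ξ in (0 : ℝ)..l, Real.exp (1 / 2 * ∫ y in ξ..l, B α ν y t (n + 1)) *
              A α ν ξ t (n + 1) * (P α ν ξ t n).eval x) +
          Real.exp (1 / 2 * ∫ y in (0 : ℝ)..l, B α ν y t (n + 1)) *
            (P α ν 0 t (n + 1)).eval x := by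
  have hsub : Set.uIcc 0 l ⊆ Set.Ici (0 : ℝ) := by
    rw [Set.uIcc_of_le hl]; exact Set.Icc_subset_Ici_self
  have hBc := continuousOn_B_succ_left hα hν ht n
  have hBi : IntervalIntegrable (fun y : ℝ => B α ν y t (n + 1)) volume 0 l :=
    (hBc.mono hsub).intervalIntegrable
  have hE : ContinuousOn (fun ξ => Real.exp (1 / 2 * ∫ y in ξ..l, B α ν y t (n + 1)))
      (Set.uIcc 0 l) :=
    (continuousOn_const.mul (intervalIntegral.continuousOn_primitive_interval_left
      ((hBc.mono hsub).integrableOn_compact isCompact_uIcc))).rexp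
  refine ⟨hBi, fun x => ?_⟩
  have hI : IntervalIntegrable (fun ξ : ℝ =>
      Real.exp (1 / 2 * ∫ y in ξ..l, B α ν y t (n + 1)) *
        A α ν ξ t (n + 1) * (P α ν ξ t n).eval x) volume 0 l :=
    ((hE.mul ((continuousOn_A_succ_left hα hν ht n).mono hsub)).mul
      ((continuousOn_eval_P_left hα hν ht n x).mono hsub)).intervalIntegrable
  refine ⟨hI, ?_⟩
  have hF := intervalIntegral.integral_eq_sub_of_hasDerivAt_of_le hl
    (f := fun ξ => Real.exp (1 / 2 * ∫ y in ξ..l, B α ν y t (n + 1)) *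
      (P α ν ξ t (n + 1)).eval x) ?_ ?_ hI
  · rw [hF]
    simp
  · rw [← Set.uIcc_of_le hl]
    exact hE.mul ((continuousOn_eval_P_left hα hν ht (n + 1) x).mono hsub)
  · intro ξ hξ
    have hcont : ContinuousOn (fun y => B α ν y t (n + 1)) (Set.Ioi 0) :=
      hBc.mono Set.Ioi_subset_Ici_self
    have h1 : HasDerivAt (fun ξ => ∫ y in ξ..l, B α ν y t (n + 1)) (-B α ν ξ t (n + 1)) ξ :=
      intervalIntegral.integral_hasDerivAt_left
        (hBi.mono_set (by
          rw [Set.uIcc_of_le hl, Set.uIcc_of_le hξ.2.le]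
          exact Set.Icc_subset_Icc_left hξ.1.le))
        (hcont.stronglyMeasurableAtFilter isOpen_Ioi ξ hξ.1)
        (hcont.continuousAt (Ioi_mem_nhds hξ.1))
    refine ((h1.const_mul (1 / 2)).exp.mul
      (hasDerivAt_eval_P_left hα hν hξ.1 ht n x)).congr_deriv ?_
    ring

end LeftParameter

/-! ### The equation in `t` -/

section RightParameter

variable {α ν l : ℝ}

theorem polyContinuousOn_right (hα : -1 < α) (hν : 0 < ν) (hl : 0 < l) (n : ℕ) :
    PolyContinuousOn (fun y => gramSchmidt (weightFunctional α ν l y) n) (Set.Ici 0) :=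
  PolyContinuousOn.gramSchmidt (m := fun y => moment α ν l y)
    (continuousOn_moment_right hα hν hl)
    (fun y hy => isPositive_moment hα hν hl.le hy (by positivity)) n

/-- The derivatives in `t` of the moments of the weight. -/
def momentDerivRight (α ν l t : ℝ) (k : ℕ) : ℝ :=
  (-(α + k + 1) * moment α ν l t k + l * moment α ν l t (k + 1)) / t

theorem momentFunctional_momentDerivRight (t : ℝ) (q : ℝ[X]) :
    momentFunctional (momentDerivRight α ν l t) q =
      (-(α + 1) * weightFunctional α ν l t q - weightFunctional α ν l t (X * derivative q) +
        l * weightFunctional α ν l t (X * q)) / t := by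
  induction q using Polynomial.induction_on' with
  | add p q hp hq =>
    rw [map_add, hp, hq, derivative_add, mul_add, mul_add]
    simp only [map_add]
    ring
  | monomial k c =>
    have h : X * derivative (monomial k c) = (c * k) • (X : ℝ[X]) ^ k := by
      rw [derivative_monomial, X_mul_monomial, smul_X_eq_monomial]
      cases k <;> simp
    have hm : monomial k c = c • (X : ℝ[X]) ^ k := (smul_X_eq_monomial).symm
    have hX : X * monomial k c = c • (X : ℝ[X]) ^ (k + 1) := by
      rw [X_mul_monomial, smul_X_eq_monomial]
    rw [h, hX, hm]
    simp only [map_smul, weightFunctional, momentFunctional_X_pow, momentDerivRight, smul_eq_mul]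
    ring

variable {t : ℝ}

/-- By Leibniz, `L(x (p_(n+1) p_k)')` reduces to `L(x p_(n+1)' p_k)`, as `x p_k'` has degree below
`n+1`. Subtracting `(n+1) p_(n+1)` changes no pairing with `p_k` and brings the degree below `n+1`;
the `p_n` term accounts for `l L(x p_(n+1) p_k)`. -/
theorem polyHasDerivAt_right (hα : -1 < α) (hν : 0 < ν) (hl : 0 < l) (ht : 0 < t) (n : ℕ) :
    PolyHasDerivAt (fun y => gramSchmidt (weightFunctional α ν l y) (n + 1))
      (t⁻¹ • (X * derivative (gramSchmidt (weightFunctional α ν l t) (n + 1)) -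
        ((n + 1 : ℕ) : ℝ) • gramSchmidt (weightFunctional α ν l t) (n + 1) -
        (l * (sqNorm α ν l t (n + 1) / sqNorm α ν l t n)) •
          gramSchmidt (weightFunctional α ν l t) n)) t := by
  have hlt : l ^ 2 + t ^ 2 ≠ 0 := by positivity
  have hp := isPositive_weightFunctional hα hν hl.le ht.le hlt
  refine polyHasDerivAt_gramSchmidt (m := fun y => moment α ν l y)
    (m' := momentDerivRight α ν l t) (fun k => (hasDerivAt_moment_right hα hν hl ht k).1)
    ?_ (n + 1) ?_ fun k hk => ?_
  · filter_upwards [Ioi_mem_nhds ht] with y hy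
    exact isPositive_moment hα hν hl.le (le_of_lt hy) (by positivity)
  · refine (degree_smul_le _ _).trans_lt ((degree_lt_iff_coeff_zero _ _).2 fun j hj => ?_)
    obtain ⟨j, rfl⟩ : ∃ i, j = i + 1 := ⟨j - 1, by lia⟩
    rw [coeff_sub, coeff_sub, coeff_smul, coeff_smul, coeff_X_mul, coeff_derivative,
      (coeff_gramSchmidt _ n).2 (j + 1) (by lia), smul_zero, sub_zero, smul_eq_mul]
    rcases (Nat.le_of_succ_le_succ hj).eq_or_lt with rfl | hj
    · push_cast; ring
    · rw [(coeff_gramSchmidt _ (n + 1)).2 (j + 1) (by lia)]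
      ring
  · change weightFunctional α ν l t (_ * gramSchmidt (weightFunctional α ν l t) k) =
      -momentFunctional (momentDerivRight α ν l t) (gramSchmidt (weightFunctional α ν l t) (n + 1) *
        gramSchmidt (weightFunctional α ν l t) k)
    rw [momentFunctional_momentDerivRight, hp.apply_gramSchmidt_mul_of_lt hk, derivative_mul,
      mul_add, map_add, ← mul_assoc X (derivative _), mul_left_comm X (gramSchmidt _ (n + 1)),
      hp.apply_gramSchmidt_mul (q := X * derivative _), smul_mul_assoc, map_smul, sub_mul, sub_mul,
      map_sub, map_sub, smul_mul_assoc, smul_mul_assoc, map_smul, map_smul,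
      hp.apply_gramSchmidt_mul_of_lt hk]
    · have : sqNorm α ν l t (n + 1) / sqNorm α ν l t n * weightFunctional α ν l t
          (gramSchmidt (weightFunctional α ν l t) n * gramSchmidt (weightFunctional α ν l t) k) =
          weightFunctional α ν l t (X * (gramSchmidt (weightFunctional α ν l t) (n + 1) *
            gramSchmidt (weightFunctional α ν l t) k)) := by
        rcases (Nat.le_of_lt_succ hk).eq_or_lt with rfl | hk
        · rw [hp.apply_X_mul_mul_pred, ← sq]
          exact div_mul_cancel₀ _ (sqNorm_pos hα hν hl.le ht.le hlt k).ne'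
        · rw [hp.apply_X_mul_mul_of_lt hk, hp.apply_gramSchmidt_mul_of_lt hk, mul_zero]
      rw [← this]
      simp only [smul_eq_mul]
      field_simp
      ring
    · rw [degree_lt_iff_coeff_zero]
      intro j hj
      obtain ⟨j, rfl⟩ : ∃ i, j = i + 1 := ⟨j - 1, by lia⟩
      rw [coeff_X_mul, coeff_derivative, (coeff_gramSchmidt _ k).2 (j + 1) (by lia), zero_mul]

theorem hasDerivAt_eval_right (hα : -1 < α) (hν : 0 < ν) (hl : 0 < l) (ht : 0 < t) (n : ℕ)
    (x : ℝ) :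
    HasDerivAt (fun y => (gramSchmidt (weightFunctional α ν l y) (n + 1)).eval x)
      ((x * (P α ν l t (n + 1)).derivative.eval x
        - (n + 1 : ℕ) * (P α ν l t (n + 1)).eval x
        - l * A α ν l t (n + 1) * (P α ν l t n).eval x) / (t * a α ν l t (n + 1))) t := by
  have hlt : l ^ 2 + t ^ 2 ≠ 0 := by positivity
  refine ((polyHasDerivAt_right hα hν hl ht n).eval x).congr_deriv ?_
  have h0 := a_ne_zero hα hν hl.le ht.le hlt (n + 1)
  rw [mul_assoc l, A_succ_mul_eval hα hν hl.le ht.le hlt, P_eq hα hν hl.le ht.le hlt (n + 1)]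
  simp only [eval_mul, eval_C, eval_smul, smul_eq_mul, eval_sub, eval_X, derivative_C_mul]
  field_simp

/-- A derivative of constant sign is integrable when its primitive is continuous on the closed
interval. -/
theorem intervalIntegrable_momentDerivRight (hα : -1 < α) (hν : 0 < ν) (hl : 0 < l)
    (ht : 0 ≤ t) (k : ℕ) :
    IntervalIntegrable (fun y => momentDerivRight α ν l y k) volume 0 t := by
  rw [← neg_neg (fun y => momentDerivRight α ν l y k)]
  refine IntervalIntegrable.neg (intervalIntegral.intervalIntegrable_deriv_of_nonneg
    (g := fun y => -moment α ν l y k) ?_ (fun y hy => ?_) fun y hy => ?_)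
  · rw [Set.uIcc_of_le ht]
    exact ((continuousOn_moment_right hα hν hl k).mono Set.Icc_subset_Ici_self).fun_neg
  · rw [min_eq_left ht] at hy
    exact (hasDerivAt_moment_right hα hν hl hy.1 k).1.fun_neg
  · rw [min_eq_left ht] at hy
    exact neg_nonneg.2 (hasDerivAt_moment_right hα hν hl hy.1 k).2

/-- The closed form of the derivative hides a cancellation against `1/y`. The expansion in the `p_k`
avoids it: its coefficients are integrable moment derivatives times functions continuous on `[0,
t]`. -/
theorem intervalIntegrable_deriv_right (hα : -1 < α) (hν : 0 < ν) (hl : 0 < l) (ht : 0 ≤ t)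
    (n : ℕ) (x : ℝ) {d : ℝ → ℝ} (hd : ∀ y, 0 < y → HasDerivAt
      (fun y => (gramSchmidt (weightFunctional α ν l y) n).eval x) (d y) y) :
    IntervalIntegrable d volume 0 t := by
  have hsub : Set.uIcc 0 t ⊆ Set.Ici (0 : ℝ) := by
    rw [Set.uIcc_of_le ht]; exact Set.Icc_subset_Ici_self
  have hc := polyContinuousOn_right hα hν hl
  have hterm : ∀ k ∈ Finset.range n, IntervalIntegrable (fun y =>
      (-momentFunctional (momentDerivRight α ν l y) (gramSchmidt (weightFunctional α ν l y) n *
          gramSchmidt (weightFunctional α ν l y) k) / sqNorm α ν l y k) *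
        (gramSchmidt (weightFunctional α ν l y) k).eval x) volume 0 t := by
    intro k _
    obtain ⟨⟨N, hN⟩, hck⟩ := (hc n).mul (hc k)
    have h1 : IntervalIntegrable (fun y => momentFunctional (momentDerivRight α ν l y)
        (gramSchmidt (weightFunctional α ν l y) n * gramSchmidt (weightFunctional α ν l y) k))
        volume 0 t := by
      simp only [fun y => momentFunctional_apply_of_le (momentDerivRight α ν l y) (hN y)]
      have := IntervalIntegrable.sum (Finset.range (N + 1)) fun j (_ : j ∈ _) =>
        (intervalIntegrable_momentDerivRight hα hν hl ht j).continuousOn_mul ((hck j).mono hsub)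
      rwa [Finset.sum_fn] at this
    have h2 : ContinuousOn (fun y => sqNorm α ν l y k) (Set.Ici 0) := by
      simp only [sqNorm, sq]
      exact ((hc k).mul (hc k)).momentFunctional (m := fun y => moment α ν l y)
        (continuousOn_moment_right hα hν hl)
    have h3 : ContinuousOn (fun y => (sqNorm α ν l y k)⁻¹) (Set.Ici 0) := h2.inv₀ fun y hy =>
      (sqNorm_pos hα hν hl.le hy (by positivity) k).ne'
    simp only [div_eq_mul_inv]
    exact (h1.neg.mul_continuousOn (h3.mono hsub)).mul_continuousOn (((hc k).eval x).mono hsub)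
  have hsum := IntervalIntegrable.sum (Finset.range n) hterm
  refine hsum.congr fun y hy => ?_
  rw [Set.uIoc_of_le ht] at hy
  have := (polyHasDerivAt_gramSchmidt_sum (m := fun y => moment α ν l y)
    (m' := momentDerivRight α ν l y) (fun k => (hasDerivAt_moment_right hα hν hl hy.1 k).1)
    (by
      filter_upwards [Ioi_mem_nhds hy.1] with y hy
      exact isPositive_moment hα hν hl.le (le_of_lt hy) (by positivity)) n).eval x
  rw [(hd y hy.1).unique this, eval_finsetSum, Finset.sum_apply]
  simp only [eval_smul, smul_eq_mul]
  rfl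

theorem integral_equation_right (hα : -1 < α) (hν : 0 < ν) (hl : 0 < l) (ht : 0 ≤ t) (n : ℕ)
    (x : ℝ) :
    IntervalIntegrable (fun y : ℝ =>
      (x * (P α ν l y (n + 1)).derivative.eval x
        - (n + 1 : ℕ) * (P α ν l y (n + 1)).eval x
        - l * A α ν l y (n + 1) * (P α ν l y n).eval x) / (y * a α ν l y (n + 1))) volume 0 t ∧
    ∫ y in (0 : ℝ)..t, (x * (P α ν l y (n + 1)).derivative.eval x
        - (n + 1 : ℕ) * (P α ν l y (n + 1)).eval x
        - l * A α ν l y (n + 1) * (P α ν l y n).eval x) / (y * a α ν l y (n + 1)) =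
      (gramSchmidt (weightFunctional α ν l t) (n + 1)).eval x -
        (gramSchmidt (weightFunctional α ν l 0) (n + 1)).eval x := by
  have hd := fun y (hy : 0 < y) => hasDerivAt_eval_right hα hν hl hy n x
  have hI := intervalIntegrable_deriv_right hα hν hl ht (n + 1) x hd
  exact ⟨hI, intervalIntegral.integral_eq_sub_of_hasDerivAt_of_le ht
    (((polyContinuousOn_right hα hν hl (n + 1)).eval x).mono Set.Icc_subset_Ici_self)
    (fun y hy => hd y hy.1) hI⟩

end RightParameter

/-! ### The Laguerre case `t = 0` -/

section Laguerre

variable {α ν l : ℝ}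

/-- The monic Laguerre polynomial in the variable `l x`. -/
def monicLaguerre (α l : ℝ) (n : ℕ) : ℝ[X] :=
  ∑ k ∈ Finset.range (n + 1), C ((-1) ^ (n - k) * n.choose k * (Real.Gamma (n + α + 1) /
    Real.Gamma (k + α + 1)) * (l ^ k / l ^ n)) * X ^ k

theorem coeff_monicLaguerre (n k : ℕ) : (monicLaguerre α l n).coeff k =
    if k ≤ n then (-1) ^ (n - k) * n.choose k * (Real.Gamma (n + α + 1) /
    Real.Gamma (k + α + 1)) * (l ^ k / l ^ n) else 0 := by
  simp only [monicLaguerre, finsetSum_coeff, coeff_C_mul, coeff_X_pow]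
  simp

theorem Gamma_add_natCast {x : ℝ} (hx : 0 < x) (j : ℕ) :
    Real.Gamma (x + j) = (ascPochhammer ℝ j).eval x * Real.Gamma x := by
  induction j with
  | zero => simp
  | succ j ih =>
    rw [ascPochhammer_succ_eval, Nat.cast_succ, ← add_assoc,
      Real.Gamma_add_one (by positivity), ih]
    ring

/-- The quotient `Γ(k+α+1+j)/Γ(k+α+1)` is the rising factorial of length `j` at `k+α+1`, a
polynomial of degree `j`. The alternating binomial sum is therefore its `n`-th forward difference at
`α+1`: zero for `j < n` and `n!` for `j = n`. -/
theorem weightFunctional_monicLaguerre (hα : -1 < α) (hν : 0 < ν) (hl : 0 < l) {n j : ℕ}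
    (hj : j ≤ n) :
    weightFunctional α ν l 0 (monicLaguerre α l n * X ^ j) =
      if j = n then n ! * Real.Gamma (n + α + 1) * Real.Gamma ν * l ^ (-(2 * n + α + 1)) else 0 := by
  have hsum : weightFunctional α ν l 0 (monicLaguerre α l n * X ^ j) =
      Real.Gamma (n + α + 1) * Real.Gamma ν * l ^ (-(n + j + α + 1)) *
        (fwdDiff 1)^[n] (fun x => (ascPochhammer ℝ j).eval x) (α + 1) := by
    rw [fwdDiff_iter_eq_sum_shift, monicLaguerre, Finset.sum_mul, map_sum, Finset.mul_sum]
    refine Finset.sum_congr rfl fun k _ => ?_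
    have hk : 0 < k + α + 1 := by have : (0 : ℝ) ≤ k := k.cast_nonneg; linarith
    have hG := (Real.Gamma_pos_of_pos hk).ne'
    rw [mul_assoc, ← pow_add, ← smul_eq_C_mul, map_smul, weightFunctional, momentFunctional_X_pow,
      moment, mellinRho_zero_right hν,
      show α + (k + j : ℕ) + 1 = (k + α + 1) + j by push_cast; ring, Gamma_add_natCast hk,
      show α + 1 + k • (1 : ℝ) = k + α + 1 by simp; ring]
    have hp : l ^ (-(k + α + 1 + j)) * (l ^ k / l ^ n) = l ^ (-(n + j + α + 1)) := by
      rw [← Real.rpow_natCast l k, ← Real.rpow_natCast l n, ← Real.rpow_sub hl,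
        ← Real.rpow_add hl]
      ring_nf
    rw [← hp]
    simp only [smul_eq_mul, zsmul_eq_mul]
    push_cast
    field_simp
  rw [hsum]
  split_ifs with h
  · subst h
    have := congrFun (Polynomial.fwdDiff_iter_degree_eq_factorial (ascPochhammer ℝ j)) (α + 1)
    rw [ascPochhammer_natDegree, (monic_ascPochhammer ℝ j).leadingCoeff] at this
    rw [this]
    simp only [one_smul, Pi.smul_apply, Pi.natCast_apply]
    ring_nf
  · have hlt : (ascPochhammer ℝ j).natDegree < n := by
      rw [ascPochhammer_natDegree]; lia
    rw [Polynomial.fwdDiff_iter_eq_zero_of_degree_lt hlt, Pi.zero_apply, mul_zero]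

theorem Gamma_natCast_add_pos (hα : -1 < α) (n : ℕ) : 0 < Real.Gamma (n + α + 1) :=
  Real.Gamma_pos_of_pos (by have : (0 : ℝ) ≤ n := n.cast_nonneg; linarith)

theorem gramSchmidt_zero_right (hα : -1 < α) (hν : 0 < ν) (hl : 0 < l) (n : ℕ) :
    gramSchmidt (weightFunctional α ν l 0) n = monicLaguerre α l n := by
  refine ((isPositive_weightFunctional hα hν hl.le le_rfl (by positivity)).eq_gramSchmidt ?_
    (fun k hk => ?_) fun k hk => ?_).symm
  · have := (Gamma_natCast_add_pos hα n).ne'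
    rw [coeff_monicLaguerre, if_pos le_rfl, div_self this, div_self (by positivity)]
    simp
  · rw [coeff_monicLaguerre, if_neg (by lia)]
  · rw [weightFunctional_monicLaguerre hα hν hl hk.le, if_neg hk.ne]

theorem a_zero_right (hα : -1 < α) (hν : 0 < ν) (hl : 0 < l) (n : ℕ) :
    a α ν l 0 n = (-1) ^ n * l ^ ((n : ℝ) + (1 + α) / 2) /
      Real.sqrt ((n ! : ℕ) * Real.Gamma (n + α + 1) * Real.Gamma ν) := by
  have hlt : l ^ 2 + (0 : ℝ) ^ 2 ≠ 0 := by positivity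
  have hG := Gamma_natCast_add_pos hα n
  have hGν := Real.Gamma_pos_of_pos hν
  rw [a_eq hα hν hl.le le_rfl hlt, sqNorm,
    (isPositive_weightFunctional hα hν hl.le le_rfl hlt).apply_sq_eq,
    gramSchmidt_zero_right hα hν hl, weightFunctional_monicLaguerre hα hν hl le_rfl, if_pos rfl,
    Real.sqrt_mul (by positivity), Real.sqrt_eq_rpow (l ^ _), ← Real.rpow_mul hl.le,
    show -(2 * (n : ℝ) + α + 1) * (1 / 2) = -(n + (1 + α) / 2) by ring, Real.rpow_neg hl.le]
  have := (Real.rpow_pos_of_pos hl (n + (1 + α) / 2)).ne'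
  field_simp

theorem coeff_laguerre (n k : ℕ) : (laguerre α n).coeff k =
    if k ≤ n then (-1) ^ k * Real.Gamma (n + α + 1) /
      (Real.Gamma (k + α + 1) * ((n - k)! : ℕ) * (k ! : ℕ)) else 0 := by
  simp [laguerre, finsetSum_coeff, coeff_C_mul, coeff_X_pow]

theorem P_zero_right (hα : -1 < α) (hν : 0 < ν) (hl : 0 < l) (n : ℕ) :
    P α ν l 0 n = modLaguerre α ν l n := by
  have hlt : l ^ 2 + (0 : ℝ) ^ 2 ≠ 0 := by positivity
  have hG := Gamma_natCast_add_pos hα n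
  have hGν := Real.Gamma_pos_of_pos hν
  ext k
  rw [P_eq hα hν hl.le le_rfl hlt, a_zero_right hα hν hl, gramSchmidt_zero_right hα hν hl,
    modLaguerre, coeff_C_mul, coeff_C_mul, comp_C_mul_X_coeff, coeff_monicLaguerre,
    coeff_laguerre]
  split_ifs with h
  · have hk := (Gamma_natCast_add_pos hα k).ne'
    have hf : (0 : ℝ) < n ! := by positivity
    have h1 : Real.sqrt (n ! / (Real.Gamma (n + α + 1) * Real.Gamma ν)) =
        n ! / Real.sqrt (n ! * Real.Gamma (n + α + 1) * Real.Gamma ν) := by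
      rw [mul_assoc, Real.sqrt_mul hf.le, Real.sqrt_div hf.le, ← div_div, Real.div_sqrt]
    have h2 : (-1 : ℝ) ^ n * (-1) ^ (n - k) = (-1) ^ k := by
      obtain ⟨j, rfl⟩ := Nat.exists_eq_add_of_le h
      rw [Nat.add_sub_cancel_left, ← pow_add, add_assoc, ← two_mul, pow_add, pow_mul, neg_one_sq,
        one_pow, mul_one]
    have h3 : Real.sqrt (n ! * Real.Gamma (n + α + 1) * Real.Gamma ν) ≠ 0 :=
      (Real.sqrt_pos.2 (by positivity)).ne'
    rw [h1, Nat.cast_choose ℝ h, ← h2, Real.rpow_add hl, Real.rpow_natCast]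
    field_simp
  · simp

end Laguerre

end

end PrudnikovLaguerre

theorem theorem4 (α ν l t : ℝ) (n : ℕ) (hα : -1 < α) (hν : 0 < ν) (hl : 0 ≤ l) (ht : 0 ≤ t)
    (hlt : l ^ 2 + t ^ 2 ≠ 0) (hn : 1 ≤ n) :
    -- the `P_m` are the orthonormal polynomials of the weight
    ((∀ m : ℕ, (PrudnikovLaguerre.P α ν l t m).natDegree = m ∧
        0 < (-1) ^ m * PrudnikovLaguerre.a α ν l t m) ∧
      (∀ m k : ℕ,
        IntegrableOn (fun x : ℝ => (PrudnikovLaguerre.P α ν l t m).eval x *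
          (PrudnikovLaguerre.P α ν l t k).eval x * PrudnikovLaguerre.weight α ν l t x)
          (Set.Ioi 0) ∧
        ∫ x in Set.Ioi (0 : ℝ), (PrudnikovLaguerre.P α ν l t m).eval x *
          (PrudnikovLaguerre.P α ν l t k).eval x * PrudnikovLaguerre.weight α ν l t x
          = if m = k then 1 else 0)) ∧
    -- the integral-difference equation in `l`
    (0 < t →
      IntervalIntegrable (fun y : ℝ => PrudnikovLaguerre.B α ν y t n) volume 0 l ∧
      ∀ x : ℝ,
        IntervalIntegrable (fun ξ : ℝ =>
          Real.exp (1 / 2 * ∫ y in ξ..l, PrudnikovLaguerre.B α ν y t n) *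
            PrudnikovLaguerre.A α ν ξ t n * (PrudnikovLaguerre.P α ν ξ t (n - 1)).eval x)
          volume 0 l ∧
        (PrudnikovLaguerre.P α ν l t n).eval x =
          (∫ ξ in (0 : ℝ)..l,
            Real.exp (1 / 2 * ∫ y in ξ..l, PrudnikovLaguerre.B α ν y t n) *
              PrudnikovLaguerre.A α ν ξ t n * (PrudnikovLaguerre.P α ν ξ t (n - 1)).eval x) +
          Real.exp (1 / 2 * ∫ y in (0 : ℝ)..l, PrudnikovLaguerre.B α ν y t n) *
            (PrudnikovLaguerre.P α ν 0 t n).eval x) ∧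
    -- the integral-difference equation in `t`
    (0 < l →
      PrudnikovLaguerre.P α ν l 0 n = PrudnikovLaguerre.modLaguerre α ν l n ∧
      PrudnikovLaguerre.a α ν l 0 n =
        (-1) ^ n * l ^ ((n : ℝ) + (1 + α) / 2) /
          Real.sqrt ((n ! : ℕ) * Real.Gamma (n + α + 1) * Real.Gamma ν) ∧
      ∀ x : ℝ,
        IntervalIntegrable (fun y : ℝ =>
          (x * (PrudnikovLaguerre.P α ν l y n).derivative.eval x
            - n * (PrudnikovLaguerre.P α ν l y n).eval x
            - l * PrudnikovLaguerre.A α ν l y n *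
                (PrudnikovLaguerre.P α ν l y (n - 1)).eval x) /
            (y * PrudnikovLaguerre.a α ν l y n)) volume 0 t ∧
        (PrudnikovLaguerre.P α ν l t n).eval x =
          PrudnikovLaguerre.a α ν l t n *
            (∫ y in (0 : ℝ)..t,
              (x * (PrudnikovLaguerre.P α ν l y n).derivative.eval x
                - n * (PrudnikovLaguerre.P α ν l y n).eval x
                - l * PrudnikovLaguerre.A α ν l y n *
                    (PrudnikovLaguerre.P α ν l y (n - 1)).eval x) /
                (y * PrudnikovLaguerre.a α ν l y n)) +
          (-1) ^ n * l ^ (-(n : ℝ) - (1 + α) / 2) *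
            Real.sqrt ((n ! : ℕ) * Real.Gamma (n + α + 1) * Real.Gamma ν) *
            PrudnikovLaguerre.a α ν l t n *
            (PrudnikovLaguerre.modLaguerre α ν l n).eval x) := by
  obtain ⟨n, rfl⟩ : ∃ k, n = k + 1 := ⟨n - 1, by lia⟩
  refine ⟨⟨fun m => ⟨PrudnikovLaguerre.natDegree_P hα hν hl ht hlt m,
    PrudnikovLaguerre.a_pos hα hν hl ht hlt m⟩, PrudnikovLaguerre.orthonormal_P hα hν hl ht hlt⟩,
    fun ht => PrudnikovLaguerre.integral_equation_left hα hν hl ht n,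
    fun hl => ⟨PrudnikovLaguerre.P_zero_right hα hν hl _,
      PrudnikovLaguerre.a_zero_right hα hν hl _, fun x => ?_⟩⟩
  obtain ⟨h1, h2⟩ := PrudnikovLaguerre.integral_equation_right hα hν hl ht n x
  refine ⟨h1, ?_⟩
  have hG := PrudnikovLaguerre.Gamma_natCast_add_pos hα (n + 1)
  have hGν := Real.Gamma_pos_of_pos hν
  -- The constant before the Laguerre term is `1/a_n(l,0)`, so that term equals `a_n(l,t)` times the
  -- monic polynomial at `t = 0`, which cancels the lower limit of the integral.
  have hs : (-1) ^ (n + 1) * l ^ (-((n + 1 : ℕ) : ℝ) - (1 + α) / 2) *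
      Real.sqrt (((n + 1)! : ℕ) * Real.Gamma ((n + 1 : ℕ) + α + 1) * Real.Gamma ν) *
      PrudnikovLaguerre.a α ν l 0 (n + 1) = 1 := by
    have h3 := (Real.sqrt_pos.2 (by positivity :
      0 < ((n + 1)! : ℕ) * Real.Gamma ((n + 1 : ℕ) + α + 1) * Real.Gamma ν)).ne'
    have h4 := (Real.rpow_pos_of_pos hl ((n + 1 : ℕ) + (1 + α) / 2)).ne'
    have h5 : ((-1 : ℝ) ^ (n + 1)) * (-1) ^ (n + 1) = 1 := by
      rw [← mul_pow]; simp
    rw [PrudnikovLaguerre.a_zero_right hα hν hl,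
      show -((n + 1 : ℕ) : ℝ) - (1 + α) / 2 = -((n + 1 : ℕ) + (1 + α) / 2) by ring,
      Real.rpow_neg hl.le, mul_assoc, mul_div_cancel₀ _ h3]
    rw [mul_mul_mul_comm, h5, inv_mul_cancel₀ h4, one_mul]
  have hP := PrudnikovLaguerre.P_eq hα hν hl.le ht hlt (n + 1)
  have hP0 := PrudnikovLaguerre.P_eq hα hν hl.le le_rfl
    (by positivity : l ^ 2 + (0 : ℝ) ^ 2 ≠ 0) (n + 1)
  rw [Nat.add_sub_cancel, h2, ← PrudnikovLaguerre.P_zero_right hα hν hl, hP, hP0,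
    Polynomial.eval_mul, Polynomial.eval_mul, Polynomial.eval_C, Polynomial.eval_C]
  linear_combination (-PrudnikovLaguerre.a α ν l t (n + 1) *
    (PrudnikovLaguerre.gramSchmidt (PrudnikovLaguerre.weightFunctional α ν l 0) (n + 1)).eval x)
    * hs
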